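/- Let $\Omega\subset\mathbb{R}^2$ be open, let $O\in\Omega$, and let $(r,\theta)$ be polar coordinates centred at $O$. Let $D,a_\mu,\mu\in\mathbb{R}$ be such that $g(\theta)=a_\mu\sin(\mu\theta)$ is $2\pi$-periodic (so $\mu$ is an integer unless $a_\mu=0$), and put $$w=r\,g(\theta),\qquad \phi=D\lambda\ln r,\qquad \lambda=\mu^2-1.$$ Let $W,\Phi\in\mathcal{D}'(\Omega)$ be given by $W(\psi)=\int_\Omega w\psi\,da$ and $\Phi(\psi)=\int_\Omega\phi\psi\,da$ for all $\psi\in\mathcal{D}(\Omega)$. Then the generalized Monge--Ampère bracket $[\Phi,W]\in\mathcal{D}'(\Omega)$ is well defined, and $$D\Delta^2W-[\Phi,W]=0\quad\text{in }\mathcal{D}'(\Omega).$$ The equation holds as an equality of distributions on all of $\Omega$, including at $O$: the transverse force is zero, with no bulk force and no force, couple or other distribution supported at $O$. Here the degree at $O$ of a (scalar, vector or tensor valued) distribution $T$ is $\inf\{s\in\mathbb{R}:\lim_{t\to0^+}t^{s}\,T(\psi_t)=0\text{ for all test functions }\psi\}-2$, with $\psi_t(x)=t^{-2}\psi(O+(x-O)/t)$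 for small $t>0$; for distributions on $\Omega\setminus\{O\}$ the test functions $\psi$ vanish near $O$. Let $B_1,B_2\in\mathcal{D}'(\Omega)$ be given on $\Omega\setminus\{O\}$ by functions $b_1,b_2$ that are smooth on $\Omega\setminus\{O\}$ and locally integrable on $\Omega$, and suppose that $\nabla B_1$, $\nabla B_2$ on $\Omega$ and $\nabla b_1\otimes\nabla b_2$ on $\Omega\setminus\{O\}$ have negative degree. Then $\nabla B_1\otimes\nabla B_2$ denotes the unique extension of $\nabla b_1\otimes\nabla b_2$ to a tensor valued distribution on $\Omega$ of the same degree, and $[B_1,B_2]=-\operatorname{Curl}\operatorname{Curl}(\nabla B_1\otimes\nabla B_2)$, where $\operatorname{Curl}V=\partial_1V_2-\partial_2V_1$ for a vector valued distribution and $\operatorname{Curl}$ of a tensor valued distribution is taken row by row. "Well defined" means that $B_1=\Phi$, $B_2=W$ satisfy these conditions and that the resulting bracket exists and is unique. -/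

import Mathlib

open MeasureTheory Filter Topology TopologicalSpace
open scoped Distributions LineDeriv ContDiff

noncomputable section

/-- The plane `ℝ²` with its Euclidean norm. -/
abbrev Plane : Type := EuclideanSpace ℝ (Fin 2)

namespace VonKarman

/-- The fixed orthonormal basis of the plane. -/
def e (i : Fin 2) : Plane := EuclideanSpace.single i 1

/-! ### Distributions on open subsets of the plane -/

/-- The distribution `ψ ↦ ∫_U f ψ` of a function `f` that is locally integrable on `U`. -/
def ofFun (U : Opens Plane) (f : Plane → ℝ) : 𝓓'(U, ℝ) where
  toFun ψ := TestFunction.integralAgainstBilinCLM (ContinuousLinearMap.mul ℝ ℝ)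
    (volume : Measure Plane) f ψ
  map_add' := map_add _
  map_smul' := map_smul _
  cont := ContinuousLinearMap.continuous _

theorem ofFun_apply {U : Opens Plane} {f : Plane → ℝ}
    (hf : LocallyIntegrableOn f (U : Set Plane)) (ψ : 𝓓(U, ℝ)) :
    ofFun U f ψ = ∫ x in (U : Set Plane), f x * ψ x := by
  have h : ofFun U f ψ = ∫ x, ψ x * f x := by
    change TestFunction.integralAgainstBilinCLM (ContinuousLinearMap.mul ℝ ℝ)
      (volume : Measure Plane) f ψ = _
    rw [TestFunction.integralAgainstBilinCLM_eq_integral hf]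
    rfl
  rw [h, setIntegral_eq_integral_of_forall_compl_eq_zero]
  · simp only [mul_comm]
  · intro x hx
    have : ψ x = 0 := image_eq_zero_of_notMem_tsupport fun h => hx (ψ.tsupport_subset h)
    simp [this]

/-- The Laplacian `ΔT = ∂₁∂₁T + ∂₂∂₂T` of a distribution. -/
def lap {U : Opens Plane} (T : 𝓓'(U, ℝ)) : 𝓓'(U, ℝ) :=
  ∂_{e 0} (∂_{e 0} T) + ∂_{e 1} (∂_{e 1} T)

/-- The gradient of a distribution. Vector valued distributions are given by components. -/
def grad {U : Opens Plane} (T : 𝓓'(U, ℝ)) : Fin 2 → 𝓓'(U, ℝ) := fun i => ∂_{e i} T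

/-- `Curl V = ∂₁V₂ - ∂₂V₁` for a vector valued distribution. -/
def curl {U : Opens Plane} (V : Fin 2 → 𝓓'(U, ℝ)) : 𝓓'(U, ℝ) :=
  ∂_{e 0} (V 1) - ∂_{e 1} (V 0)

/-- The curl of a tensor valued distribution `T = (T i j)`; as `⟨Curl T, a⟩ = Curl (Tᵀ a)`, it is
the curl of each row. -/
def curlTensor {U : Opens Plane} (T : Fin 2 × Fin 2 → 𝓓'(U, ℝ)) : Fin 2 → 𝓓'(U, ℝ) :=
  fun i => curl fun j => T (i, j)

/-- The punctured open set `Ω - O`. -/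
def puncture (Ω : Opens Plane) (O : Plane) : Opens Plane :=
  ⟨(Ω : Set Plane) \ {O}, Ω.isOpen.sdiff isClosed_singleton⟩

theorem puncture_le (Ω : Opens Plane) (O : Plane) : puncture Ω O ≤ Ω :=
  fun _ hx => hx.1

/-- Extension by zero of a test function on `Ω - O` to a test function on `Ω`. -/
def extendTest {Ω : Opens Plane} {O : Plane} (ψ : 𝓓(puncture Ω O, ℝ)) : 𝓓(Ω, ℝ) :=
  TestFunction.monoCLM ℝ ψ

theorem coe_extendTest {Ω : Opens Plane} {O : Plane} (ψ : 𝓓(puncture Ω O, ℝ)) :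
    (extendTest ψ : Plane → ℝ) = ψ := by
  simp [extendTest, puncture_le Ω O]

/-- The restriction of a distribution on `Ω` to `Ω - O`. -/
def restrictOff {Ω : Opens Plane} (O : Plane) (T : 𝓓'(Ω, ℝ)) : 𝓓'(puncture Ω O, ℝ) where
  toFun ψ := T (extendTest ψ)
  map_add' ψ₁ ψ₂ := by simp [extendTest]
  map_smul' c ψ := by simp [extendTest]
  cont := T.continuous.comp (TestFunction.monoCLM ℝ).continuous

/-! ### Degree of a distribution at a point -/

/-- For small `t > 0` the test function `ψ t` is the dilation `x ↦ t⁻² φ(x / t)` of `φ`, where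
`O` is taken as the origin. -/
def IsDilationFamily {U : Opens Plane} (O : Plane) (φ : Plane → ℝ) (ψ : ℝ → 𝓓(U, ℝ)) : Prop :=
  ∀ᶠ t in 𝓝[>] (0 : ℝ), ∀ x, ψ t x = (t ^ 2)⁻¹ * φ (O + t⁻¹ • (x - O))

/-- The degree at `O` of a family of distributions (the components of a vector or tensor valued
distribution): `inf {s ∈ ℝ | t ^ s T(φ_t) → 0 as t → 0+, for all φ} - 2`, where `φ_t` is the
dilation of `φ`. It is defined on an open set `U` that contains `O` and on `U - O` alike; in the
latter case only functions `φ` that vanish near `O` have dilations. -/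
def degree {ι : Type} {U : Opens Plane} (O : Plane) (T : ι → 𝓓'(U, ℝ)) : EReal :=
  sInf {m : EReal | ∃ s : ℝ, m = (s : EReal) ∧
    ∀ (i : ι) (φ : Plane → ℝ) (ψ : ℝ → 𝓓(U, ℝ)), IsDilationFamily O φ ψ →
      Tendsto (fun t : ℝ => t ^ s * T i (ψ t)) (𝓝[>] 0) (𝓝 0)} - ((2 : ℝ) : EReal)

/-! ### The generalized Monge-Ampère bracket of fields that are singular at one point -/

/-- `B` has the bulk density `b`, which is smooth away from `O`. -/
structure HasBulkDensity {Ω : Opens Plane} (O : Plane) (B : 𝓓'(Ω, ℝ)) (b : Plane → ℝ) :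
    Prop where
  smooth : ContDiffOn ℝ ∞ b ((Ω : Set Plane) \ {O})
  locallyIntegrable : LocallyIntegrableOn b (Ω : Set Plane)
  eq_off : ∀ ψ : 𝓓(puncture Ω O, ℝ),
    restrictOff O B ψ = ∫ x in (puncture Ω O : Set Plane), b x * ψ x

/-- The tensor valued distribution on `Ω - O` given by the pointwise dyadic product
`∇b₁ ⊗ ∇b₂` of two functions that are smooth there. -/
def dyadOff (Ω : Opens Plane) (O : Plane) (b₁ b₂ : Plane → ℝ) :
    Fin 2 × Fin 2 → 𝓓'(puncture Ω O, ℝ) :=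
  fun p => ofFun (puncture Ω O) fun x => fderiv ℝ b₁ x (e p.1) * fderiv ℝ b₂ x (e p.2)

/-- The conditions under which the bracket `[B₁, B₂]` is defined: `B₁` and `B₂` have bulk
densities `b₁` and `b₂`, smooth away from `O`, and `∇B₁`, `∇B₂` and `∇b₁ ⊗ ∇b₂` on `Ω - O`
have negative degree. -/
structure BracketAdmissible {Ω : Opens Plane} (O : Plane) (B₁ B₂ : 𝓓'(Ω, ℝ))
    (b₁ b₂ : Plane → ℝ) : Prop where
  density₁ : HasBulkDensity O B₁ b₁
  density₂ : HasBulkDensity O B₂ b₂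
  degree₁ : degree O (grad B₁) < 0
  degree₂ : degree O (grad B₂) < 0
  degree_dyad : degree O (dyadOff Ω O b₁ b₂) < 0

/-- `T` is the dyadic product `∇B₁ ⊗ ∇B₂`: the extension of `∇b₁ ⊗ ∇b₂` from `Ω - O` to `Ω`
with the same (negative) degree. -/
structure IsDyad {Ω : Opens Plane} (O : Plane) (b₁ b₂ : Plane → ℝ)
    (T : Fin 2 × Fin 2 → 𝓓'(Ω, ℝ)) : Prop where
  extends_off : ∀ p, restrictOff O (T p) = dyadOff Ω O b₁ b₂ p
  degree_eq : degree O T = degree O (dyadOff Ω O b₁ b₂)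

/-- `M` is the generalized Monge-Ampère bracket `[B₁, B₂] = -Curl Curl (∇B₁ ⊗ ∇B₂)`. -/
def IsMongeAmpereBracket {Ω : Opens Plane} (O : Plane) (B₁ B₂ M : 𝓓'(Ω, ℝ)) : Prop :=
  ∃ (b₁ b₂ : Plane → ℝ) (T : Fin 2 × Fin 2 → 𝓓'(Ω, ℝ)),
    BracketAdmissible O B₁ B₂ b₁ b₂ ∧ IsDyad O b₁ b₂ T ∧ M = -curl (curlTensor T)

/-- The generalized Monge-Ampère bracket `[B₁, B₂]` (arbitrary if it is not defined). -/
def mongeAmpere {Ω : Opens Plane} (O : Plane) (B₁ B₂ : 𝓓'(Ω, ℝ)) : 𝓓'(Ω, ℝ) :=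
  Classical.epsilon (IsMongeAmpereBracket O B₁ B₂)

/-! ### The conical deformation and the logarithmic stress function -/

/-- The polar radius with centre `O`. -/
def polarRadius (O x : Plane) : ℝ := ‖x - O‖

/-- The polar angle with centre `O`, with values in `(-π, π]`. -/
def polarAngle (O x : Plane) : ℝ := Complex.arg ⟨x 0 - O 0, x 1 - O 1⟩

/-- The conical deformation `w = r g(θ)`. -/
def cone (O : Plane) (g : ℝ → ℝ) (x : Plane) : ℝ := polarRadius O x * g (polarAngle O x)

/-- The logarithmic stress function `φ = D l ln r`. -/
def logStress (O : Plane) (D l : ℝ) (x : Plane) : ℝ := D * l * Real.log (polarRadius O x)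

end VonKarman

end

/-! Write `λ = μ² - 1`. The field `∇φ` is homogeneous of degree `-1` about `O` and `∇w` of degree
`0`, so `∇φ ⊗ ∇w` is homogeneous of degree `-1`. In the plane such a function is locally integrable.
Integration against it is therefore a distribution on all of `Ω`, and the scaling law `T(ψ_t) = t⁻¹
T(ψ)` gives it the same degree as its restriction to `Ω - O` (`degree_ofFun_eq`).

Uniqueness rests on the fact that a distribution `S` supported at `O` and of negative degree is zero
(`eq_zero_of_restrictOff_eq_zero`). By finite order, `S` annihilates test functions that are flat
enough at `O`. The flatness needed is then lowered one order at a time. If `ψ` vanishes to order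
`k`, then `ψ_t - t^(-2-k) ψ` vanishes to order `k + 1`, so `S ψ_t = t^(-2-k) S ψ`, and negative
degree forces `S ψ = 0`.

For the equation, test against `ψ` and use polar coordinates. Up to the factor `D`, the first term
is `∫∫ (1 - n²) g Δψ dr dθ`, because `Δ(r g) = (g + g'') / r` (`integral_cone_mul_laplacian`). The
second is the integral of `∇φ ⊗ ∇w` against the cofactor of the Hessian of `ψ`. Since `∇w = g e_r +
g' e_θ` does not depend on `r`, the two integrands add up to `-D λ ∂_r (∇w · ∇ψ)`. What remains is
`D λ ∇ψ(O) · ∫ ∇w dθ`, a possible couple at `O`. The mean of `∇w` over the circle is zero unless `n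
= 1`, and then `λ = 0` (`integral_grad_cone`, `transverse_balance`). -/

/-! ### Taylor estimates for smooth functions that are flat at a point -/

section Jets

variable {E : Type} [NormedAddCommGroup E] [NormedSpace ℝ E]

/-- A smooth map whose derivatives of order less than `m` vanish at `O` is `O(|x - O| ^ m)`,
together with its derivatives. -/
theorem exists_norm_iteratedFDeriv_le_of_jet_eq_zero [ProperSpace E] (O : E) (m : ℕ) :
    ∀ {F : Type} [NormedAddCommGroup F] [NormedSpace ℝ F] (f : E → F), ContDiff ℝ ∞ f →
      (∀ i < m, iteratedFDeriv ℝ i f O = 0) →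
      ∃ C, 0 ≤ C ∧ ∀ i ≤ m, ∀ x ∈ Metric.closedBall O 1,
        ‖iteratedFDeriv ℝ i f x‖ ≤ C * ‖x - O‖ ^ (m - i) := by
  induction m with
  | zero =>
    intro F _ _ f hf _
    obtain ⟨C, hC⟩ := (isCompact_closedBall O 1).exists_bound_of_continuousOn
      (hf.continuous_iteratedFDeriv (m := 0) (by simp)).continuousOn
    refine ⟨max C 0, le_max_right _ _, fun i hi x hx => ?_⟩
    obtain rfl : i = 0 := by omega
    simpa using Or.inl (hC x hx)
  | succ m ih =>
    intro F _ _ f hf h0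
    -- The jet of `fderiv ℝ f` vanishes to one order less. Its values lie in a space of linear maps,
    -- hence the induction over all targets `F`.
    obtain ⟨C, hC0, hC⟩ := ih (fderiv ℝ f) (hf.fderiv_right (by simp)) fun i hi => by
      rw [← norm_eq_zero, norm_iteratedFDeriv_fderiv, h0 (i + 1) (by omega), norm_zero]
    refine ⟨C, hC0, fun i hi x hx => ?_⟩
    rcases i with _ | i
    · have hfO : f O = 0 := by
        have := congrArg (fun L => L 0) (h0 0 (by omega))
        simpa using this
      have hxO : ‖x - O‖ ≤ 1 := by simpa [dist_eq_norm] using hx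
      -- Mean value inequality on the ball of radius `‖x - O‖`, where the derivative is at most `C *
      -- ‖x - O‖ ^ m`; this gains the last power.
      have := (convex_closedBall O ‖x - O‖).norm_image_sub_le_of_norm_fderiv_le (𝕜 := ℝ) (f := f)
        (C := C * ‖x - O‖ ^ m) (x := O) (y := x)
        (fun y _ => (hf.differentiable (by simp)).differentiableAt)
        (fun y hy => by
          have hy' : ‖y - O‖ ≤ ‖x - O‖ := by simpa [dist_eq_norm] using hy
          have h1 := hC 0 (by omega) y (by
            simpa [dist_eq_norm] using hy'.trans hxO)
          rw [norm_iteratedFDeriv_zero] at h1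
          refine h1.trans ?_
          rw [Nat.sub_zero]
          gcongr)
        (by simp) (by simp [dist_eq_norm])
      rw [norm_iteratedFDeriv_zero]
      rw [hfO, sub_zero, mul_assoc, ← pow_succ] at this
      simpa using this
    · have h1 := hC i (by omega) x hx
      rw [norm_iteratedFDeriv_fderiv] at h1
      simpa using h1

theorem iteratedFDeriv_comp_dilation {F : Type} [NormedAddCommGroup F] [NormedSpace ℝ F]
    {f : E → F} (hf : ContDiff ℝ ∞ f) (O : E) (c : ℝ) (a : E) (i : ℕ) (x : E) :
    iteratedFDeriv ℝ i (fun x => f (a + c • (x - O))) x =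
      c ^ i • iteratedFDeriv ℝ i f (a + c • (x - O)) := by
  have h1 : ContDiff ℝ ∞ fun y => f (a + y) := hf.comp (by fun_prop)
  have h2 := congrFun (iteratedFDeriv_comp_const_smul c (h1.of_le (n := ∞) (m := i)
    (by exact_mod_cast le_top))) (x - O)
  rw [iteratedFDeriv_comp_sub (f := fun y => f (a + c • y)), h2]
  rw [iteratedFDeriv_comp_add_left]

/-- Cutting off a smooth function that vanishes to order `N` at `O` at distance `ε` from `O` gives
a function that is `O(ε)` in the `C ^ N` norm. -/
theorem exists_norm_iteratedFDeriv_cutoff_le [ProperSpace E] {χ : E → ℝ}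
    (hχ : ContDiff ℝ ∞ χ) (hχc : HasCompactSupport χ)
    (hχs : tsupport χ ⊆ Metric.closedBall 0 1) (O : E) (N : ℕ) {f : E → ℝ}
    (hf : ContDiff ℝ ∞ f) (h0 : ∀ i ≤ N, iteratedFDeriv ℝ i f O = 0) :
    ∃ C, 0 ≤ C ∧ ∀ ε : ℝ, 0 < ε → ε ≤ 1 → ∀ i ≤ N, ∀ x,
      ‖iteratedFDeriv ℝ i (fun x => χ (ε⁻¹ • (x - O)) * f x) x‖ ≤ C * ε := by
  -- In the Leibniz rule, `j` derivatives of the cutoff cost `ε ^ (-j)`, while `i - j` derivatives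
  -- of `f` are `O(ε ^ (N + 1 - (i - j)))`, which is `O(ε ^ (j + 1))` as `i ≤ N`. One factor `ε`
  -- survives.
  obtain ⟨C, hC0, hC⟩ := exists_norm_iteratedFDeriv_le_of_jet_eq_zero O (N + 1) f hf
    fun i hi => h0 i (by omega)
  have hM : ∀ j : ℕ, ∃ M, ∀ x, ‖iteratedFDeriv ℝ j χ x‖ ≤ M := fun j =>
    (hχ.continuous_iteratedFDeriv (m := j)
      (by exact_mod_cast le_top)).bounded_above_of_compact_support
      (hχc.iteratedFDeriv j)
  choose M hM using hM
  have hM0 : ∀ j, 0 ≤ M j := fun j => (norm_nonneg _).trans (hM j 0)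
  refine ⟨∑ i ∈ Finset.range (N + 1), ∑ j ∈ Finset.range (i + 1), (i.choose j : ℝ) * M j * C,
    Finset.sum_nonneg fun i _ => Finset.sum_nonneg fun j _ => by have := hM0 j; positivity,
    fun ε hε hε1 i hi x => ?_⟩
  have hχε : ContDiff ℝ ∞ fun x => χ (ε⁻¹ • (x - O)) := hχ.comp (by fun_prop)
  by_cases hx : ‖x - O‖ ≤ ε
  · have h1 := norm_iteratedFDeriv_mul_le hχε hf x (n := i) (by exact_mod_cast le_top)
    refine h1.trans ?_
    calc _ ≤ ∑ j ∈ Finset.range (i + 1), (i.choose j : ℝ) * M j * C * ε := ?_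
      _ = (∑ j ∈ Finset.range (i + 1), (i.choose j : ℝ) * M j * C) * ε := by
        rw [Finset.sum_mul]
      _ ≤ _ := by
        gcongr
        exact Finset.single_le_sum
          (f := fun i => ∑ j ∈ Finset.range (i + 1), (i.choose j : ℝ) * M j * C)
          (fun i _ => Finset.sum_nonneg fun j _ => by have := hM0 j; positivity)
          (Finset.mem_range.2 (by omega))
    refine Finset.sum_le_sum fun j hj => ?_
    have hj' : j ≤ i := by simpa [Nat.lt_succ_iff] using hj
    have h2 : ‖iteratedFDeriv ℝ j (fun x => χ (ε⁻¹ • (x - O))) x‖ ≤ ε⁻¹ ^ j * M j := by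
      have := iteratedFDeriv_comp_dilation hχ O ε⁻¹ 0 j x
      simp only [zero_add] at this
      rw [this, norm_smul, norm_pow, Real.norm_of_nonneg (by positivity)]
      gcongr
      exact hM j _
    have h3 : ‖iteratedFDeriv ℝ (i - j) f x‖ ≤ C * ε ^ (j + 1) := by
      refine (hC (i - j) (by omega) x (by simpa [dist_eq_norm] using hx.trans hε1)).trans ?_
      gcongr
      calc ‖x - O‖ ^ (N + 1 - (i - j)) ≤ ε ^ (N + 1 - (i - j)) := by gcongr
        _ ≤ ε ^ (j + 1) := pow_le_pow_of_le_one hε.le hε1 (by omega)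
    calc _ ≤ (i.choose j : ℝ) * (ε⁻¹ ^ j * M j) * (C * ε ^ (j + 1)) := by
          have := hM0 j
          gcongr
      _ = (i.choose j : ℝ) * M j * C * ε * (ε⁻¹ * ε) ^ j := by
          rw [mul_pow]; ring
      _ = _ := by rw [inv_mul_cancel₀ hε.ne', one_pow, mul_one]
  · have : (fun x => χ (ε⁻¹ • (x - O)) * f x) =ᶠ[𝓝 x] fun _ => 0 := by
      have h1 : ∀ᶠ y in 𝓝 x, ε < ‖y - O‖ :=
        (continuous_norm.comp (continuous_sub_right O)).continuousAt.eventually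
          (lt_mem_nhds (not_le.1 hx))
      filter_upwards [h1] with y hy
      have : χ (ε⁻¹ • (y - O)) = 0 := by
        refine image_eq_zero_of_notMem_tsupport fun h => ?_
        have := hχs h
        rw [mem_closedBall_zero_iff, norm_smul, Real.norm_of_nonneg (by positivity),
          inv_mul_le_iff₀ hε, mul_one] at this
        exact absurd this (not_le.2 hy)
      simp [this]
    rw [(this.iteratedFDeriv ℝ i).eq_of_nhds]
    have : iteratedFDeriv ℝ i (fun _ : E => (0 : ℝ)) x = 0 := by
      simp
    rw [this, norm_zero]
    have : 0 ≤ ∑ i ∈ Finset.range (N + 1), ∑ j ∈ Finset.range (i + 1), (i.choose j : ℝ) * M j * C :=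
      Finset.sum_nonneg fun i _ => Finset.sum_nonneg fun j _ => by have := hM0 j; positivity
    positivity

end Jets

/-! ### Finite order of distributions -/

namespace Distribution

/-- A distribution has finite order on every compact set. -/
theorem exists_order {E : Type} [NormedAddCommGroup E] [NormedSpace ℝ E] {Ω : Opens E}
    (S : 𝓓'(Ω, ℝ)) (K : Compacts E) (hK : (K : Set E) ⊆ Ω) :
    ∃ (N : ℕ) (C : ℝ), 0 ≤ C ∧ ∀ ψ : 𝓓(Ω, ℝ), tsupport ψ ⊆ K → ∀ B, 0 ≤ B →
      (∀ i ≤ N, ∀ x, ‖iteratedFDeriv ℝ i ψ x‖ ≤ B) → |S ψ| ≤ C * B := by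
  let q : Seminorm ℝ 𝓓_{K}(E, ℝ) :=
    (normSeminorm ℝ ℝ).comp (S.toLinearMap ∘ₗ (TestFunction.ofSupportedInCLM ℝ hK).toLinearMap)
  have hq : Continuous q := by
    change Continuous fun f => ‖S (TestFunction.ofSupportedInCLM ℝ hK f)‖
    exact (S.continuous.comp (TestFunction.ofSupportedInCLM ℝ hK).continuous).norm
  obtain ⟨s, C, -, hC⟩ := Seminorm.bound_of_continuous
    (ContDiffMapSupportedIn.withSeminorms ℝ E ℝ ⊤ K) q hq
  -- Continuity on functions supported in `K` involves only a finite set `s` of seminorms; the order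
  -- is the largest index in it.
  refine ⟨s.sup id, C, C.2, fun ψ hψ B hB h => ?_⟩
  let f : 𝓓_{K}(E, ℝ) := .of_support_subset ψ.contDiff ((subset_tsupport _).trans hψ)
  have h1 := hC f
  have h2 : (s.sup (ContDiffMapSupportedIn.seminorm ℝ E ℝ ⊤ K)) f ≤ B := by
    refine Seminorm.finset_sup_apply_le hB fun i hi => ?_
    rw [ContDiffMapSupportedIn.seminorm_top_le_iff ℝ hB]
    exact fun x _ => h i (Finset.le_sup (f := id) hi) x
  calc |S ψ| = q f := rfl
    _ ≤ C * (s.sup (ContDiffMapSupportedIn.seminorm ℝ E ℝ ⊤ K)) f := h1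
    _ ≤ C * B := by gcongr

end Distribution

/-! ### Dilations of test functions -/

namespace VonKarman

/-- The dilation `x ↦ t⁻² φ(x / t)` of a function on the plane, where `O` is the origin. -/
noncomputable def dilation (O : Plane) (φ : Plane → ℝ) (t : ℝ) (x : Plane) : ℝ :=
  (t ^ 2)⁻¹ * φ (O + t⁻¹ • (x - O))

section Dilation

variable {O : Plane} {φ : Plane → ℝ} {U : Opens Plane}

theorem contDiff_dilation (hφ : ContDiff ℝ ∞ φ) (t : ℝ) : ContDiff ℝ ∞ (dilation O φ t) :=
  contDiff_const.mul (hφ.comp (by fun_prop))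

theorem tsupport_dilation_subset (t : ℝ) :
    tsupport (dilation O φ t) ⊆ {x | O + t⁻¹ • (x - O) ∈ tsupport φ} := by
  refine closure_minimal (fun x hx => ?_) ((isClosed_tsupport φ).preimage (by fun_prop))
  refine subset_tsupport _ fun h => hx ?_
  simp [dilation, h]

theorem add_smul_inv_smul {t : ℝ} (ht : t ≠ 0) (x : Plane) :
    O + t • ((O + t⁻¹ • (x - O)) - O) = x := by
  rw [add_sub_cancel_left, smul_inv_smul₀ ht, add_sub_cancel]

theorem hasCompactSupport_dilation (hφ : HasCompactSupport φ) {t : ℝ} (ht : t ≠ 0) :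
    HasCompactSupport (dilation O φ t) := by
  have : IsCompact ((fun y => O + t • (y - O)) '' tsupport φ) := hφ.image (by fun_prop)
  refine this.of_isClosed_subset (isClosed_tsupport _) fun x hx => ?_
  exact ⟨_, tsupport_dilation_subset t hx, add_smul_inv_smul ht x⟩

/-- If the dilations of the support of `φ` are eventually in `U`, then `φ` has a dilation family
of test functions on `U`. -/
theorem exists_isDilationFamily (hφ : ContDiff ℝ ∞ φ) (hc : HasCompactSupport φ)
    (hU : ∀ᶠ t in 𝓝[>] (0 : ℝ), ∀ x, O + t⁻¹ • (x - O) ∈ tsupport φ → x ∈ U) :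
    ∃ ψ : ℝ → 𝓓(U, ℝ), IsDilationFamily O φ ψ := by
  classical
  let ψ : ℝ → 𝓓(U, ℝ) := fun t =>
    -- The value `0` at the other `t` is harmless, as a dilation family is prescribed only for small
    -- `t > 0`.
    if h : t ≠ 0 ∧ ∀ x, O + t⁻¹ • (x - O) ∈ tsupport φ → x ∈ U then
      ⟨dilation O φ t, contDiff_dilation hφ t, hasCompactSupport_dilation hc h.1,
        (tsupport_dilation_subset t).trans h.2⟩
    else 0
  refine ⟨ψ, ?_⟩
  filter_upwards [hU, self_mem_nhdsWithin] with t ht (ht0 : 0 < t) x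
  have : ψ t = ⟨dilation O φ t, contDiff_dilation hφ t, hasCompactSupport_dilation hc ht0.ne',
        (tsupport_dilation_subset t).trans ht⟩ := dif_pos ⟨ht0.ne', ht⟩
  rw [this]
  rfl

theorem eventually_mem_of_dilation_mem_compact {Ω : Opens Plane} (hO : O ∈ Ω) {K : Set Plane}
    (hK : IsCompact K) :
    ∀ᶠ t in 𝓝[>] (0 : ℝ), ∀ x, O + t⁻¹ • (x - O) ∈ K → x ∈ Ω := by
  obtain ⟨R, hR⟩ := hK.isBounded.subset_closedBall O
  obtain ⟨ε, hε, hεΩ⟩ := Metric.isOpen_iff.1 Ω.isOpen O hO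
  have h1 : Tendsto (fun t : ℝ => t * R) (𝓝[>] 0) (𝓝 0) := by
    have : Tendsto (fun t : ℝ => t * R) (𝓝 0) (𝓝 (0 * R)) :=
      (continuous_id.mul continuous_const).tendsto 0
    rw [zero_mul] at this
    exact this.mono_left nhdsWithin_le_nhds
  filter_upwards [h1.eventually (gt_mem_nhds hε), self_mem_nhdsWithin] with t ht (ht0 : 0 < t) x hx
  refine hεΩ ?_
  have h2 := hR hx
  rw [Metric.mem_closedBall, dist_eq_norm, add_sub_cancel_left, norm_smul,
    Real.norm_of_nonneg (by positivity), inv_mul_le_iff₀ ht0] at h2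
  rw [Metric.mem_ball, dist_eq_norm]
  exact h2.trans_lt ht

theorem exists_isDilationFamily_of_mem {Ω : Opens Plane} (hO : O ∈ Ω) (hφ : ContDiff ℝ ∞ φ)
    (hc : HasCompactSupport φ) : ∃ ψ : ℝ → 𝓓(Ω, ℝ), IsDilationFamily O φ ψ :=
  exists_isDilationFamily hφ hc (eventually_mem_of_dilation_mem_compact hO hc)

theorem exists_isDilationFamily_puncture {Ω : Opens Plane} (hO : O ∈ Ω) (hφ : ContDiff ℝ ∞ φ)
    (hc : HasCompactSupport φ) (hφO : O ∉ tsupport φ) :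
    ∃ ψ : ℝ → 𝓓(puncture Ω O, ℝ), IsDilationFamily O φ ψ := by
  refine exists_isDilationFamily hφ hc ?_
  filter_upwards [eventually_mem_of_dilation_mem_compact hO hc] with t ht x hx
  refine ⟨ht x hx, ?_⟩
  rintro rfl
  exact hφO (by simpa using hx)

/-- The definition of a dilation family asks nothing of `φ` itself, but undoing the scaling at a
single small `t` exhibits `φ` as a rescaled test function. -/
theorem IsDilationFamily.contDiff_hasCompactSupport {ψ : ℝ → 𝓓(U, ℝ)} (h : IsDilationFamily O φ ψ) :
    ContDiff ℝ ∞ φ ∧ HasCompactSupport φ := by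
  obtain ⟨t, ht, ht0⟩ := (h.and self_mem_nhdsWithin).exists
  replace ht0 : 0 < t := ht0
  have : φ = fun y => t ^ 2 * ψ t (O + t • (y - O)) := by
    funext y
    rw [ht, add_sub_cancel_left, inv_smul_smul₀ ht0.ne', add_sub_cancel,
      mul_inv_cancel_left₀ (by positivity)]
  constructor
  · rw [this]
    exact contDiff_const.mul ((ψ t).contDiff.comp (by fun_prop))
  · have hK : IsCompact ((fun x => O + t⁻¹ • (x - O)) '' tsupport (ψ t)) :=
      (ψ t).hasCompactSupport.image (by fun_prop)
    refine HasCompactSupport.intro hK fun y hy => ?_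
    rw [this]
    have : ψ t (O + t • (y - O)) = 0 := by
      refine image_eq_zero_of_notMem_tsupport fun hm => hy ⟨_, hm, ?_⟩
      simp only
      rw [add_sub_cancel_left, inv_smul_smul₀ ht0.ne', add_sub_cancel]
    simp [this]

/-! ### Distributions supported at a point -/

/-- A test function that vanishes near `O` is the extension of a test function on `Ω - O`. -/
theorem exists_extendTest_eq {Ω : Opens Plane} (ψ : 𝓓(Ω, ℝ)) (h : ψ =ᶠ[𝓝 O] 0) :
    ∃ η : 𝓓(puncture Ω O, ℝ), extendTest η = ψ := by
  refine ⟨⟨ψ, ψ.contDiff, ψ.hasCompactSupport, fun x hx => ⟨ψ.tsupport_subset hx, ?_⟩⟩, ?_⟩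
  · rintro rfl
    exact notMem_tsupport_iff_eventuallyEq.2 h hx
  · ext x
    rw [coe_extendTest]
    rfl

/-- A distribution that vanishes off `O` depends only on the germ of the test function at `O`. -/
theorem eq_of_eventuallyEq {Ω : Opens Plane} {S : 𝓓'(Ω, ℝ)} (hS : restrictOff O S = 0)
    {ψ₁ ψ₂ : 𝓓(Ω, ℝ)} (h : ψ₁ =ᶠ[𝓝 O] ψ₂) : S ψ₁ = S ψ₂ := by
  obtain ⟨η, hη⟩ := exists_extendTest_eq (O := O) (ψ₁ - ψ₂) (by
    filter_upwards [h] with x hx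
    simp [hx])
  have h1 : S (extendTest η) = 0 := congrArg (fun T : 𝓓'(puncture Ω O, ℝ) => T η) hS
  rw [hη, map_sub] at h1
  exact sub_eq_zero.1 h1

/-- A distribution that vanishes off `O` annihilates the test functions that vanish at `O` to a
sufficiently high order. -/
theorem exists_order_of_restrictOff_eq_zero {Ω : Opens Plane} (hO : O ∈ Ω) {S : 𝓓'(Ω, ℝ)}
    (hS : restrictOff O S = 0) :
    ∃ N : ℕ, ∀ ψ : 𝓓(Ω, ℝ), (∀ i < N, iteratedFDeriv ℝ i ψ O = 0) → S ψ = 0 := by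
  obtain ⟨δ, hδ, hδΩ⟩ := Metric.nhds_basis_closedBall.mem_iff.1 (Ω.isOpen.mem_nhds hO)
  let K : Compacts Plane := ⟨Metric.closedBall O δ, isCompact_closedBall O δ⟩
  obtain ⟨N, C, hC0, hC⟩ := Distribution.exists_order S K hδΩ
  refine ⟨N + 1, fun ψ hψ => ?_⟩
  let χ : ContDiffBump (0 : Plane) := ⟨1 / 2, 1, by norm_num, by norm_num⟩
  have hχ : ContDiff ℝ ∞ χ := χ.contDiff
  have hχs : tsupport χ ⊆ Metric.closedBall 0 1 := χ.tsupport_eq.subset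
  obtain ⟨B, hB0, hB⟩ := exists_norm_iteratedFDeriv_cutoff_le hχ χ.hasCompactSupport hχs O N
    ψ.contDiff fun i hi => hψ i (by omega)
  -- `S` sees only the germ at `O`, so `ψ` may be replaced by its cutoff at scale `ε`, which is
  -- `O(ε)` in the norm that bounds `S`.
  have key : ∀ ε : ℝ, 0 < ε → ε ≤ min 1 δ → |S ψ| ≤ C * (B * ε) := by
    intro ε hε hε1
    have hsupp : tsupport (fun x => χ (ε⁻¹ • (x - O)) * ψ x) ⊆ Metric.closedBall O ε := by
      refine closure_minimal (fun x hx => ?_) Metric.isClosed_closedBall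
      have : ε⁻¹ • (x - O) ∈ Metric.closedBall (0 : Plane) 1 :=
        hχs (subset_tsupport _ fun h => hx (by simp [h]))
      rw [mem_closedBall_zero_iff, norm_smul, Real.norm_of_nonneg (by positivity),
        inv_mul_le_iff₀ hε, mul_one] at this
      rwa [Metric.mem_closedBall, dist_eq_norm]
    have hK : Metric.closedBall O ε ⊆ K :=
      Metric.closedBall_subset_closedBall (hε1.trans (min_le_right _ _))
    let η : 𝓓(Ω, ℝ) := ⟨fun x => χ (ε⁻¹ • (x - O)) * ψ x,
      (hχ.comp (by fun_prop)).mul ψ.contDiff, ψ.hasCompactSupport.mul_left,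
      (hsupp.trans hK).trans hδΩ⟩
    have h1 : S ψ = S η := by
      refine eq_of_eventuallyEq hS ?_
      have : ∀ᶠ x in 𝓝 O, ε⁻¹ • (x - O) ∈ Metric.ball (0 : Plane) (1 / 2) := by
        refine ContinuousAt.eventually_mem (by fun_prop) ?_
        simpa using Metric.ball_mem_nhds (0 : Plane) (by norm_num : (0 : ℝ) < 1 / 2)
      filter_upwards [this] with x hx
      change ψ x = χ (ε⁻¹ • (x - O)) * ψ x
      rw [χ.one_of_mem_closedBall (Metric.ball_subset_closedBall hx), one_mul]
    rw [h1]
    exact hC η (hsupp.trans hK) _ (by positivity) fun i hi x =>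
      hB ε hε (hε1.trans (min_le_left _ _)) i hi x
  have h2 : Tendsto (fun ε : ℝ => C * (B * ε)) (𝓝[>] 0) (𝓝 0) := by
    have : Tendsto (fun ε : ℝ => C * (B * ε)) (𝓝 0) (𝓝 (C * (B * 0))) :=
      Continuous.tendsto (by fun_prop) 0
    rw [mul_zero, mul_zero] at this
    exact this.mono_left nhdsWithin_le_nhds
  have h3 : |S ψ| ≤ 0 := by
    refine ge_of_tendsto h2 ?_
    have : Set.Ioc 0 (min 1 δ) ∈ 𝓝[>] (0 : ℝ) := Ioc_mem_nhdsGT (by positivity)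
    filter_upwards [this] with ε hε
    exact key ε hε.1 hε.2
  exact abs_nonpos_iff.1 h3

/-- A distribution that is supported at `O` and is of negative degree there is zero. -/
theorem eq_zero_of_restrictOff_eq_zero {Ω : Opens Plane} (hO : O ∈ Ω) {S : 𝓓'(Ω, ℝ)}
    (hS : restrictOff O S = 0) {s : ℝ} (hs : s < 2)
    (hdeg : ∀ (φ : Plane → ℝ) (ψ : ℝ → 𝓓(Ω, ℝ)), IsDilationFamily O φ ψ →
      Tendsto (fun t : ℝ => t ^ s * S (ψ t)) (𝓝[>] 0) (𝓝 0)) : S = 0 := by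
  obtain ⟨N, hN⟩ := exists_order_of_restrictOff_eq_zero hO hS
  -- Descending induction on the order of vanishing at `O`; at order `0` the condition on `ψ` is
  -- empty.
  have step : ∀ k : ℕ, (∀ ψ : 𝓓(Ω, ℝ), (∀ i < k, iteratedFDeriv ℝ i ψ O = 0) → S ψ = 0) →
      ∀ ψ : 𝓓(Ω, ℝ), S ψ = 0 := by
    intro k
    induction k with
    | zero => exact fun h ψ => h ψ (by simp)
    | succ k ih =>
      refine fun h => ih fun ψ hψ => ?_
      obtain ⟨ψt, hψt⟩ := exists_isDilationFamily_of_mem hO ψ.contDiff ψ.hasCompactSupport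
      have h1 : ∀ᶠ t in 𝓝[>] (0 : ℝ), t ^ s * S (ψt t) = t ^ (s - 2 - k) * S ψ := by
        filter_upwards [hψt, self_mem_nhdsWithin] with t ht (ht0 : 0 < t)
        have h2 : (ψt t : Plane → ℝ) =
            (t ^ 2)⁻¹ • fun x => ψ (O + t⁻¹ • (x - O)) := funext fun x => by
          rw [ht]; rfl
        have hcd : ContDiff ℝ ∞ fun x => ψ (O + t⁻¹ • (x - O)) := ψ.contDiff.comp (by fun_prop)
        -- Dilation multiplies the `k`-th derivative at `O`, the first that may be nonzero, by
        -- exactly this factor, so the difference is flat to one more order.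
        have h3 : S (ψt t - ((t ^ 2)⁻¹ * t⁻¹ ^ k) • ψ) = 0 := by
          refine h _ fun i hi => ?_
          have hi' : ((i : ℕ∞) : WithTop ℕ∞) ≤ ∞ := by exact_mod_cast le_top
          have h4 : iteratedFDeriv ℝ i (ψt t) O =
              (t ^ 2)⁻¹ • t⁻¹ ^ i • iteratedFDeriv ℝ i ψ O := by
            rw [h2, iteratedFDeriv_const_smul_apply (hcd.contDiffAt.of_le hi'),
              iteratedFDeriv_comp_dilation ψ.contDiff]
            simp
          have h5 : iteratedFDeriv ℝ i (ψt t - ((t ^ 2)⁻¹ * t⁻¹ ^ k) • ψ : 𝓓(Ω, ℝ)) O =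
              iteratedFDeriv ℝ i (ψt t) O -
                ((t ^ 2)⁻¹ * t⁻¹ ^ k) • iteratedFDeriv ℝ i ψ O := by
            rw [FunLike.coe_sub, FunLike.coe_smul, iteratedFDeriv_sub_apply
              (g := ((t ^ 2)⁻¹ * t⁻¹ ^ k) • (ψ : Plane → ℝ)) ((ψt t).contDiff.contDiffAt.of_le hi')
              (contDiffAt_const.smul (ψ.contDiff.contDiffAt.of_le hi')),
              iteratedFDeriv_const_smul_apply (ψ.contDiff.contDiffAt.of_le hi')]
          rw [h5, h4]
          rcases Nat.lt_succ_iff_lt_or_eq.1 hi with hlt | rfl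
          · simp [hψ i hlt]
          · rw [smul_smul, sub_self]
        rw [map_sub, map_smul, sub_eq_zero] at h3
        rw [h3, smul_eq_mul, Real.rpow_sub ht0, Real.rpow_sub ht0, Real.rpow_natCast]
        norm_num [inv_pow]
        field_simp
      have h2 := (hdeg ψ ψt hψt).congr' h1
      -- Since `s - 2 - k < 0`, the power of `t` is at least `1` for `t < 1`, so `|S ψ|` is bounded
      -- by a quantity that tends to `0`.
      have h3 : |S ψ| ≤ 0 := by
        have h4 : Tendsto (fun t : ℝ => |t ^ (s - 2 - k) * S ψ|) (𝓝[>] 0) (𝓝 0) := by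
          simpa using h2.abs
        refine ge_of_tendsto h4 ?_
        have : Set.Ioo 0 1 ∈ 𝓝[>] (0 : ℝ) := Ioo_mem_nhdsGT one_pos
        filter_upwards [this] with t ht
        rw [abs_mul]
        refine le_mul_of_one_le_left (abs_nonneg _) ?_
        refine le_trans ?_ (le_abs_self _)
        refine (Real.one_le_rpow_of_pos_of_le_one_of_nonpos ht.1 ht.2.le ?_)
        have : (0 : ℝ) ≤ k := k.cast_nonneg
        linarith
      exact abs_nonpos_iff.1 h3
  ext ψ
  exact step N hN ψ

/-! ### Admissible exponents and uniqueness of extensions of negative degree -/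

/-- The exponents that enter the definition of the degree. -/
def IsDegreeExponent {ι : Type} {U : Opens Plane} (O : Plane) (T : ι → 𝓓'(U, ℝ)) (s : ℝ) : Prop :=
  ∀ (i : ι) (φ : Plane → ℝ) (ψ : ℝ → 𝓓(U, ℝ)), IsDilationFamily O φ ψ →
    Tendsto (fun t : ℝ => t ^ s * T i (ψ t)) (𝓝[>] 0) (𝓝 0)

theorem degree_eq_sInf {ι : Type} (T : ι → 𝓓'(U, ℝ)) :
    degree O T = sInf {m : EReal | ∃ s : ℝ, m = s ∧ IsDegreeExponent O T s} - ((2 : ℝ) : EReal) :=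
  rfl

/-- Later arguments use this form of negative degree; the value of a degree is never computed. -/
theorem degree_lt_zero_iff {ι : Type} {T : ι → 𝓓'(U, ℝ)} :
    degree O T < 0 ↔ ∃ s < 2, IsDegreeExponent O T s := by
  rw [degree_eq_sInf, EReal.sub_lt_iff (by simp) (by simp), zero_add, sInf_lt_iff]
  constructor
  · rintro ⟨_, ⟨s, rfl, hs⟩, h⟩
    exact ⟨s, by exact_mod_cast h, hs⟩
  · rintro ⟨s, h, hs⟩
    exact ⟨s, ⟨s, rfl, hs⟩, by exact_mod_cast h⟩

theorem IsDegreeExponent.mono {ι : Type} {T : ι → 𝓓'(U, ℝ)} {s s' : ℝ}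
    (h : IsDegreeExponent O T s) (hs : s ≤ s') : IsDegreeExponent O T s' := by
  intro i φ ψ hψ
  refine squeeze_zero_norm' ?_ (by simpa using (h i φ ψ hψ).norm)
  have : Set.Ioo 0 1 ∈ 𝓝[>] (0 : ℝ) := Ioo_mem_nhdsGT one_pos
  filter_upwards [this] with t ht
  rw [norm_mul]
  gcongr ?_ * _
  have h1 := Real.rpow_le_rpow_of_exponent_ge ht.1 ht.2.le hs
  rwa [Real.norm_of_nonneg (Real.rpow_nonneg ht.1.le _),
    abs_of_nonneg (Real.rpow_nonneg ht.1.le _)]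

/-- A family of distributions of negative degree is determined by its restriction to `Ω - O`. -/
theorem eq_of_restrictOff_eq {ι : Type} {Ω : Opens Plane} (hO : O ∈ Ω) {T T' : ι → 𝓓'(Ω, ℝ)}
    (h : ∀ i, restrictOff O (T i) = restrictOff O (T' i)) (hT : degree O T < 0)
    (hT' : degree O T' < 0) : T = T' := by
  obtain ⟨s, hs2, hs⟩ := degree_lt_zero_iff.1 hT
  obtain ⟨s', hs2', hs'⟩ := degree_lt_zero_iff.1 hT'
  funext i
  rw [← sub_eq_zero]
  refine eq_zero_of_restrictOff_eq_zero hO (s := max s s') ?_ (max_lt hs2 hs2') ?_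
  · ext ψ
    have := congrArg (fun S : 𝓓'(puncture Ω O, ℝ) => S ψ) (h i)
    exact sub_eq_zero.2 this
  · intro φ ψ hψ
    have := ((hs.mono (le_max_left s s')) i φ ψ hψ).sub
      ((hs'.mono (le_max_right s s')) i φ ψ hψ)
    rw [sub_zero] at this
    refine this.congr fun t => ?_
    rw [← mul_sub]
    rfl

end Dilation

variable {O : Plane} {U Ω : Opens Plane}

/-! ### Integration of singular functions against dilations -/

/-- The area element `r dr dθ` of the plane cancels the singularity, leaving the constant `1` on
`(0, R]`. -/
theorem locallyIntegrable_inv_norm_sub (O : Plane) :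
    LocallyIntegrable (fun x : Plane => ‖x - O‖⁻¹) := by
  have h0 : ∀ R : ℝ, IntegrableOn (fun x : Plane => ‖x‖⁻¹) (Metric.closedBall 0 R) := by
    intro R
    have h1 : Integrable (fun x : Plane => (Set.Iic R).indicator (fun y : ℝ => y⁻¹) ‖x‖) := by
      rw [integrable_fun_norm_addHaar]
      simp only [finrank_euclideanSpace, Fintype.card_fin]
      have h2 : IntegrableOn ((Set.Iic R).indicator fun _ : ℝ => (1 : ℝ)) (Set.Ioi 0) := by
        rw [integrableOn_indicator_iff measurableSet_Iic]
        refine integrableOn_const ?_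
        rw [Set.Iic_inter_Ioi]
        exact measure_Ioc_lt_top.ne
      refine h2.congr_fun (fun y hy => ?_) measurableSet_Ioi
      have hy' : y ≠ 0 := ne_of_gt hy
      by_cases h : y ∈ Set.Iic R <;> simp [h, hy']
    rw [← integrable_indicator_iff Metric.isClosed_closedBall.measurableSet]
    refine h1.congr (Eventually.of_forall fun x => ?_)
    by_cases h : ‖x‖ ≤ R
    · simp [Set.indicator, h]
    · simp [Set.indicator, h]
  have h : LocallyIntegrable (fun x : Plane => ‖x‖⁻¹) := by
    rw [locallyIntegrable_iff]
    intro K hK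
    obtain ⟨R, hR⟩ := hK.isBounded.subset_closedBall 0
    exact (h0 R).mono_set hR
  rw [locallyIntegrable_iff] at h ⊢
  intro K hK
  have h1 := h _ (hK.image (continuous_sub_right O))
  have h2 : MeasurePreserving (fun x : Plane => x - O) := measurePreserving_sub_right volume O
  have h3 : MeasurableEmbedding (fun x : Plane => x - O) := measurableEmbedding_subRight O
  rw [h2.integrableOn_image h3] at h1
  exact h1

theorem aestronglyMeasurable_of_continuousOn_compl {f : Plane → ℝ} (hf : ContinuousOn f {O}ᶜ) :
    AEStronglyMeasurable f := by
  have := hf.aestronglyMeasurable (μ := volume) (measurableSet_singleton O).compl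
  rwa [Measure.restrict_eq_self_of_ae_mem] at this
  exact compl_mem_ae_iff.2 (measure_singleton O)

theorem ae_ne (O : Plane) : ∀ᵐ x : Plane, x ≠ O :=
  compl_mem_ae_iff.2 (measure_singleton O)

/-- One bound serves all the fields here: `1 / r` covers the dyad, `r` the cone, and their sum the
logarithm. -/
theorem locallyIntegrable_of_norm_le {f : Plane → ℝ} (hf : ContinuousOn f {O}ᶜ) {C : ℝ}
    (hC : ∀ x ≠ O, |f x| ≤ C * (‖x - O‖⁻¹ + ‖x - O‖)) : LocallyIntegrable f := by
  have h1 : LocallyIntegrable fun x : Plane => C * (‖x - O‖⁻¹ + ‖x - O‖) :=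
    ((locallyIntegrable_inv_norm_sub O).add
      (continuous_sub_right O).norm.locallyIntegrable).smul C
  refine h1.mono (aestronglyMeasurable_of_continuousOn_compl hf) ?_
  filter_upwards [ae_ne O] with x hx
  exact (hC x hx).trans (le_abs_self _)

/-- A function that is continuous off `O` and homogeneous of degree `-1` is bounded by a multiple
of `1 / r`. -/
theorem exists_le_inv_norm_of_homogeneous {f : Plane → ℝ} (hf : ContinuousOn f {O}ᶜ)
    (hh : ∀ t > 0, ∀ v ≠ 0, f (O + t • v) = t⁻¹ * f (O + v)) :
    ∃ C, ∀ x ≠ O, |f x| ≤ C * ‖x - O‖⁻¹ := by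
  obtain ⟨C, hC⟩ := (isCompact_sphere O 1).exists_bound_of_continuousOn
    (hf.mono fun x hx => by
      rintro rfl
      simp at hx)
  refine ⟨C, fun x hx => ?_⟩
  have h0 : 0 < ‖x - O‖ := norm_pos_iff.2 (sub_ne_zero.2 hx)
  have h1 := hh ‖x - O‖ h0 (‖x - O‖⁻¹ • (x - O))
    (smul_ne_zero (inv_ne_zero h0.ne') (sub_ne_zero.2 hx))
  rw [smul_inv_smul₀ h0.ne', add_sub_cancel] at h1
  rw [h1, abs_mul, abs_of_pos (inv_pos.2 h0), mul_comm]
  gcongr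
  refine hC _ ?_
  rw [mem_sphere_iff_norm, add_sub_cancel_left, norm_smul, norm_inv, norm_norm,
    inv_mul_cancel₀ h0.ne']

theorem locallyIntegrable_of_homogeneous {f : Plane → ℝ} (hf : ContinuousOn f {O}ᶜ)
    (hh : ∀ t > 0, ∀ v ≠ 0, f (O + t • v) = t⁻¹ * f (O + v)) : LocallyIntegrable f := by
  obtain ⟨C, hC⟩ := exists_le_inv_norm_of_homogeneous hf hh
  refine locallyIntegrable_of_norm_le hf (C := max C 0) fun x hx => (hC x hx).trans ?_
  gcongr
  · exact le_max_left _ _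
  · exact le_add_of_nonneg_right (norm_nonneg _)

/-- The factor `t⁻²` of the dilation is cancelled by the Jacobian, so scaling moves from the test
function to the integrand. -/
theorem integral_mul_dilation (F φ : Plane → ℝ) {t : ℝ} (ht : 0 < t) :
    ∫ x, F x * dilation O φ t x = ∫ x, F (O + t • (x - O)) * φ x := by
  have h1 : ∀ x, F x * dilation O φ t x =
      (t ^ 2)⁻¹ * ((fun x => F (O + t • (x - O)) * φ x) (O + t⁻¹ • (x - O))) := fun x => by
    simp only [dilation]
    rw [add_smul_inv_smul ht.ne']
    ring
  simp_rw [h1]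
  rw [integral_const_mul, integral_sub_right_eq_self
    (fun x => F (O + t • ((O + t⁻¹ • x) - O)) * φ (O + t⁻¹ • x)) O,
    Measure.integral_comp_inv_smul volume
    (fun x => F (O + t • ((O + x) - O)) * φ (O + x)) t]
  rw [integral_add_left_eq_self (fun x => F (O + t • (x - O)) * φ x) O]
  rw [finrank_euclideanSpace, Fintype.card_fin, abs_of_pos (by positivity), smul_eq_mul,
    inv_mul_cancel_left₀ (by positivity)]

theorem setIntegral_mul_testFunction (f : Plane → ℝ) (ψ : 𝓓(U, ℝ)) :
    ∫ x in (U : Set Plane), f x * ψ x = ∫ x, f x * ψ x := by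
  refine setIntegral_eq_integral_of_forall_compl_eq_zero fun x hx => ?_
  have : ψ x = 0 := image_eq_zero_of_notMem_tsupport fun h => hx (ψ.tsupport_subset h)
  simp [this]

theorem ofFun_apply_eq_integral {f : Plane → ℝ} (hf : LocallyIntegrableOn f (U : Set Plane))
    (ψ : 𝓓(U, ℝ)) : ofFun U f ψ = ∫ x, f x * ψ x := by
  rw [ofFun_apply hf, setIntegral_mul_testFunction]

theorem restrictOff_ofFun {f : Plane → ℝ} (hf : LocallyIntegrableOn f (Ω : Set Plane)) :
    restrictOff O (ofFun Ω f) = ofFun (puncture Ω O) f := by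
  ext ψ
  change ofFun Ω f (extendTest ψ) = _
  rw [ofFun_apply_eq_integral hf, ofFun_apply_eq_integral (hf.mono_set (puncture_le Ω O)),
    coe_extendTest]

/-! ### Degrees -/

theorem tendsto_rpow_nhdsGT_zero {s : ℝ} (hs : 0 < s) :
    Tendsto (fun t : ℝ => t ^ s) (𝓝[>] 0) (𝓝 0) := by
  have := (Real.continuousAt_rpow_const 0 s (Or.inr hs.le)).tendsto
  rw [Real.zero_rpow hs.ne'] at this
  exact this.mono_left nhdsWithin_le_nhds

section Homogeneous

variable {ι : Type} {f : ι → Plane → ℝ}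

theorem ofFun_dilation_eq {f : Plane → ℝ} (hl : LocallyIntegrable f)
    (hh : ∀ t > 0, ∀ v ≠ 0, f (O + t • v) = t⁻¹ * f (O + v)) {φ : Plane → ℝ} {ψ : ℝ → 𝓓(U, ℝ)}
    (hψ : IsDilationFamily O φ ψ) :
    ∀ᶠ t in 𝓝[>] (0 : ℝ), ofFun U f (ψ t) = t⁻¹ * ∫ x, f x * φ x := by
  filter_upwards [hψ, self_mem_nhdsWithin] with t ht (ht0 : 0 < t)
  rw [ofFun_apply_eq_integral (hl.locallyIntegrableOn _)]
  have : (ψ t : Plane → ℝ) = dilation O φ t := funext ht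
  rw [this, integral_mul_dilation f φ ht0, ← integral_const_mul]
  refine integral_congr_ae ?_
  filter_upwards [ae_ne O] with x hx
  rw [hh t ht0 _ (sub_ne_zero.2 hx), add_sub_cancel, mul_assoc]

theorem isDegreeExponent_ofFun_of_one_lt (hl : ∀ i, LocallyIntegrable (f i))
    (hh : ∀ i, ∀ t > 0, ∀ v ≠ 0, f i (O + t • v) = t⁻¹ * f i (O + v)) {s : ℝ} (hs : 1 < s) :
    IsDegreeExponent O (fun i => ofFun U (f i)) s := by
  intro i φ ψ hψ
  have h1 := (tendsto_rpow_nhdsGT_zero (sub_pos.2 hs)).mul_const (∫ x, f i x * φ x)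
  rw [zero_mul] at h1
  refine h1.congr' ?_
  filter_upwards [ofFun_dilation_eq (hl i) (hh i) hψ, self_mem_nhdsWithin] with t ht (ht0 : 0 < t)
  rw [ht, Real.rpow_sub ht0, Real.rpow_one]
  field_simp

/-- By the scaling law, `t ^ (s - 1) * ∫ f φ` tends to `0` although `s - 1 ≤ 0`, so the integral is
zero for every `φ` that vanishes near `O`; such `φ` determine `f` almost everywhere. -/
theorem ae_eq_zero_of_isDegreeExponent (hO : O ∈ Ω) (hl : ∀ i, LocallyIntegrable (f i))
    (hh : ∀ i, ∀ t > 0, ∀ v ≠ 0, f i (O + t • v) = t⁻¹ * f i (O + v)) {s : ℝ} (hs : s ≤ 1)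
    (h : IsDegreeExponent O (fun i => ofFun (puncture Ω O) (f i)) s) (i : ι) :
    ∀ᵐ x, f i x = 0 := by
  have h1 := isOpen_compl_singleton.ae_eq_zero_of_integral_contDiff_smul_eq_zero
    (U := {O}ᶜ) ((hl i).locallyIntegrableOn _) fun g hg hc hs' => ?_
  · filter_upwards [h1, ae_ne O] with x hx hx'
    exact hx hx'
  · have hgO : O ∉ tsupport g := fun hm => hs' hm rfl
    obtain ⟨ψ, hψ⟩ := exists_isDilationFamily_puncture hO hg hc hgO
    have h2 : Tendsto (fun t : ℝ => t ^ (s - 1) * ∫ x, f i x * g x) (𝓝[>] 0) (𝓝 0) := by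
      refine (h i g ψ hψ).congr' ?_
      filter_upwards [ofFun_dilation_eq (hl i) (hh i) hψ, self_mem_nhdsWithin]
        with t ht (ht0 : 0 < t)
      rw [ht, Real.rpow_sub ht0, Real.rpow_one]
      field_simp
    have h3 : |∫ x, f i x * g x| ≤ 0 := by
      have h4 := h2.abs
      rw [abs_zero] at h4
      refine ge_of_tendsto h4 ?_
      have : Set.Ioo 0 1 ∈ 𝓝[>] (0 : ℝ) := Ioo_mem_nhdsGT one_pos
      filter_upwards [this] with t ht
      rw [abs_mul]
      refine le_mul_of_one_le_left (abs_nonneg _) (le_trans ?_ (le_abs_self _))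
      exact Real.one_le_rpow_of_pos_of_le_one_of_nonpos ht.1 ht.2.le (by linarith)
    simpa [mul_comm] using abs_nonpos_iff.1 h3

/-- Exponents `s > 1` are admissible on both sets. An exponent `s ≤ 1` on `Ω - O` forces `f = 0`
almost everywhere, and then it is admissible on `Ω` too. This includes the case of the zero dyad. -/
theorem degree_ofFun_eq (hO : O ∈ Ω) (hl : ∀ i, LocallyIntegrable (f i))
    (hh : ∀ i, ∀ t > 0, ∀ v ≠ 0, f i (O + t • v) = t⁻¹ * f i (O + v)) :
    degree O (fun i => ofFun Ω (f i)) = degree O (fun i => ofFun (puncture Ω O) (f i)) := by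
  have : ∀ s, IsDegreeExponent O (fun i => ofFun Ω (f i)) s ↔
      IsDegreeExponent O (fun i => ofFun (puncture Ω O) (f i)) s := by
    intro s
    constructor
    · intro h i φ ψ hψ
      refine (h i φ (fun t => extendTest (ψ t)) ?_).congr fun t => ?_
      · filter_upwards [hψ] with t ht x
        rw [coe_extendTest, ht]
      · rw [ofFun_apply_eq_integral ((hl i).locallyIntegrableOn _),
          ofFun_apply_eq_integral ((hl i).locallyIntegrableOn _), coe_extendTest]
    · intro h
      rcases lt_or_ge 1 s with hs | hs
      · exact isDegreeExponent_ofFun_of_one_lt hl hh hs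
      · intro i φ ψ hψ
        refine tendsto_const_nhds.congr fun t => ?_
        have h0 := ae_eq_zero_of_isDegreeExponent hO hl hh hs h i
        rw [ofFun_apply_eq_integral ((hl i).locallyIntegrableOn _)]
        have : ∫ x, f i x * ψ t x = 0 := by
          refine integral_eq_zero_of_ae ?_
          filter_upwards [h0] with x hx
          simp [hx]
        rw [this, mul_zero]
  rw [degree_eq_sInf, degree_eq_sInf]
  simp only [this]

theorem degree_ofFun_neg (hl : ∀ i, LocallyIntegrable (f i))
    (hh : ∀ i, ∀ t > 0, ∀ v ≠ 0, f i (O + t • v) = t⁻¹ * f i (O + v)) :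
    degree O (fun i => ofFun U (f i)) < 0 :=
  degree_lt_zero_iff.2 ⟨3 / 2, by norm_num,
    isDegreeExponent_ofFun_of_one_lt hl hh (by norm_num)⟩

end Homogeneous

theorem coe_lineDeriv (ψ : 𝓓(U, ℝ)) (v : Plane) :
    (∂_{v} ψ : 𝓓(U, ℝ)) = fun x => fderiv ℝ ψ x v := by
  funext x
  rw [TestFunction.lineDerivOp_eq_lineDerivCLM ℝ, TestFunction.lineDerivCLM_eq_fderivCLM,
    TestFunction.fderivCLM_apply_of_le ψ (by simp)]

theorem fderiv_dilation {φ : Plane → ℝ} (hφ : ContDiff ℝ ∞ φ) (t : ℝ) (x v : Plane) :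
    fderiv ℝ (dilation O φ t) x v = t⁻¹ * dilation O (fun y => fderiv ℝ φ y v) t x := by
  have h1 : HasFDerivAt (fun x : Plane => O + t⁻¹ • (x - O))
      (t⁻¹ • ContinuousLinearMap.id ℝ Plane) x :=
    (((hasFDerivAt_id x).sub_const O).const_smul t⁻¹).const_add O
  have h2 := (((hφ.differentiable (by simp)).differentiableAt
    (x := O + t⁻¹ • (x - O))).hasFDerivAt.comp x h1).const_mul (t ^ 2)⁻¹
  have h3 : fderiv ℝ (dilation O φ t) x = _ := h2.fderiv
  rw [h3]
  simp [dilation]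
  ring

/-- The gradient of a locally integrable function `b` such that `b (t x)` is asymptotically smaller
than `t ^ (-1 / 2)` has negative degree. -/
theorem degree_grad_neg {B : 𝓓'(Ω, ℝ)} {b : Plane → ℝ}
    (hB : ∀ ψ : 𝓓(Ω, ℝ), B ψ = ∫ x in (Ω : Set Plane), b x * ψ x) (hb : LocallyIntegrable b)
    {α β : ℝ → ℝ} (hh : ∀ t > 0, ∀ v ≠ 0, b (O + t • v) = α t * b (O + v) + β t)
    (hα : Tendsto (fun t => t ^ (1 / 2 : ℝ) * α t) (𝓝[>] 0) (𝓝 0))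
    (hβ : Tendsto (fun t => t ^ (1 / 2 : ℝ) * β t) (𝓝[>] 0) (𝓝 0)) :
    degree O (grad B) < 0 := by
  rw [degree_lt_zero_iff]
  -- The derivative moved to the test function costs `t⁻¹`, which leaves `t ^ (1 / 2)` against `α`
  -- and `β`.
  refine ⟨3 / 2, by norm_num, fun i φ ψ hψ => ?_⟩
  obtain ⟨hφ, hc⟩ := hψ.contDiff_hasCompactSupport
  set η : Plane → ℝ := fun y => fderiv ℝ φ y (e i) with hη
  have hηc : Continuous η := (hφ.continuous_fderiv (by simp)).clm_apply continuous_const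
  have hηs : HasCompactSupport η := hc.fderiv_apply ℝ (e i)
  have h1 : Integrable fun x => b x * η x := by
    simpa [mul_comm] using hb.integrable_smul_left_of_hasCompactSupport hηc hηs
  have h2 : Integrable η := hηc.integrable_of_hasCompactSupport hηs
  have h3 := ((hα.mul_const (∫ x, b x * η x)).add (hβ.mul_const (∫ x, η x))).neg
  simp only [zero_mul, add_zero, neg_zero] at h3
  refine h3.congr' ?_
  filter_upwards [hψ, self_mem_nhdsWithin] with t ht (ht0 : 0 < t)
  have h4 : (ψ t : Plane → ℝ) = dilation O φ t := funext ht
  change _ = t ^ (3 / 2 : ℝ) * (∂_{e i} B) (ψ t)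
  rw [Distribution.lineDerivOp_apply_apply, map_neg, hB, setIntegral_mul_testFunction,
    coe_lineDeriv, h4]
  simp_rw [fderiv_dilation hφ, mul_left_comm _ t⁻¹]
  rw [integral_const_mul, integral_mul_dilation b η ht0]
  have h5 : ∫ x, b (O + t • (x - O)) * η x = α t * (∫ x, b x * η x) + β t * ∫ x, η x := by
    rw [← integral_const_mul, ← integral_const_mul, ← integral_add (h1.const_mul _)
      (h2.const_mul _)]
    refine integral_congr_ae ?_
    filter_upwards [ae_ne O] with x hx
    rw [hh t ht0 _ (sub_ne_zero.2 hx), add_sub_cancel]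
    ring
  rw [h5, show (3 / 2 : ℝ) = 1 / 2 + 1 by norm_num, Real.rpow_add ht0, Real.rpow_one]
  field_simp

/-! ### Uniqueness of the bracket -/

/-- Equal integrals give equality almost everywhere, and continuity off `O` makes it pointwise. Thus
the existential choice of densities in the bracket does not matter. -/
theorem HasBulkDensity.eqOn {B : 𝓓'(Ω, ℝ)} {b b' : Plane → ℝ} (h : HasBulkDensity O B b)
    (h' : HasBulkDensity O B b') : Set.EqOn b b' (puncture Ω O) := by
  have hl : LocallyIntegrableOn b (puncture Ω O : Set Plane) :=
    h.locallyIntegrable.mono_set (puncture_le Ω O)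
  have hl' : LocallyIntegrableOn b' (puncture Ω O : Set Plane) :=
    h'.locallyIntegrable.mono_set (puncture_le Ω O)
  have h1 := (puncture Ω O).isOpen.ae_eq_zero_of_integral_contDiff_smul_eq_zero (hl.sub hl')
    fun g hg hc hs => by
      let ψ : 𝓓(puncture Ω O, ℝ) := ⟨g, hg, hc, hs⟩
      have h2 := (h.eq_off ψ).symm.trans (h'.eq_off ψ)
      rw [← ofFun_apply hl, ← ofFun_apply hl', ofFun_apply_eq_integral hl,
        ofFun_apply_eq_integral hl'] at h2
      have hi : ∀ {f : Plane → ℝ}, LocallyIntegrableOn f (puncture Ω O : Set Plane) →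
          Integrable fun x => g x • f x := fun {f} hf => by
        have h3 : IntegrableOn (fun x => g x • f x) (tsupport g) :=
          (hf.integrableOn_compact_subset hs hc).continuousOn_mul hg.continuous.continuousOn hc
        refine (integrableOn_iff_integrable_of_support_subset fun x hx => ?_).1 h3
        exact subset_tsupport _ fun h0 => hx (by simp [h0])
      simp only [Pi.sub_apply, smul_sub]
      rw [integral_sub (hi hl) (hi hl'), sub_eq_zero]
      simpa [ψ, mul_comm] using h2
  refine Measure.eqOn_open_of_ae_eq (μ := volume) ?_ (puncture Ω O).isOpen h.smooth.continuousOn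
    h'.smooth.continuousOn
  rw [EventuallyEq, ae_restrict_iff' (puncture Ω O).isOpen.measurableSet]
  filter_upwards [h1] with x hx hxU
  exact sub_eq_zero.1 (hx hxU)

theorem ofFun_congr {f f' : Plane → ℝ} (hf : LocallyIntegrableOn f (U : Set Plane))
    (h : Set.EqOn f f' U) : ofFun U f = ofFun U f' := by
  ext ψ
  rw [ofFun_apply hf, ofFun_apply
    (hf.congr ((ae_restrict_iff' U.isOpen.measurableSet).2 (Eventually.of_forall h)))]
  exact setIntegral_congr_fun U.isOpen.measurableSet fun x hx => by simp [h hx]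

theorem locallyIntegrableOn_fderiv_mul_fderiv {b₁ b₂ : Plane → ℝ} (h₁ : ContDiffOn ℝ ∞ b₁ U)
    (h₂ : ContDiffOn ℝ ∞ b₂ U) (v w : Plane) :
    LocallyIntegrableOn (fun x => fderiv ℝ b₁ x v * fderiv ℝ b₂ x w) (U : Set Plane) :=
  (((h₁.continuousOn_fderiv_of_isOpen U.isOpen (by simp)).clm_apply continuousOn_const).mul
    ((h₂.continuousOn_fderiv_of_isOpen U.isOpen (by simp)).clm_apply
      continuousOn_const)).locallyIntegrableOn U.isOpen.measurableSet

/-- Densities that agree on the open set `Ω - O` have the same derivatives there, so both dyads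
extend the same distribution with negative degree and hence coincide. -/
theorem IsMongeAmpereBracket.unique (hO : O ∈ Ω) {B₁ B₂ M M' : 𝓓'(Ω, ℝ)}
    (h : IsMongeAmpereBracket O B₁ B₂ M) (h' : IsMongeAmpereBracket O B₁ B₂ M') : M = M' := by
  obtain ⟨b₁, b₂, T, hb, hT, rfl⟩ := h
  obtain ⟨b₁', b₂', T', hb', hT', rfl⟩ := h'
  have hd : ∀ p, dyadOff Ω O b₁ b₂ p = dyadOff Ω O b₁' b₂' p := fun p => by
    refine ofFun_congr
      (locallyIntegrableOn_fderiv_mul_fderiv hb.density₁.smooth hb.density₂.smooth _ _)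
      fun x hx => ?_
    have hx' := (puncture Ω O).isOpen.mem_nhds hx
    rw [((hb.density₁.eqOn hb'.density₁).eventuallyEq_of_mem hx').fderiv_eq,
      ((hb.density₂.eqOn hb'.density₂).eventuallyEq_of_mem hx').fderiv_eq]
  have : T = T' := eq_of_restrictOff_eq hO
    (fun p => by rw [hT.extends_off, hT'.extends_off, hd])
    (hT.degree_eq ▸ hb.degree_dyad) (hT'.degree_eq ▸ hb'.degree_dyad)
  rw [this]

/-! ### Polar coordinates about `O` -/

/-- The unit vector at angle `θ`. -/
noncomputable def radial (θ : ℝ) : Plane := !₂[Real.cos θ, Real.sin θ]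

/-- The point with polar coordinates `(r, θ)` about `O`. -/
noncomputable def polarPoint (O : Plane) (r θ : ℝ) : Plane := O + r • radial θ

theorem polarPoint_apply_zero (r θ : ℝ) : polarPoint O r θ 0 = O 0 + r * Real.cos θ := by
  simp [polarPoint, radial]

theorem polarPoint_apply_one (r θ : ℝ) : polarPoint O r θ 1 = O 1 + r * Real.sin θ := by
  simp [polarPoint, radial]

theorem norm_radial (θ : ℝ) : ‖radial θ‖ = 1 := by
  simp [radial, EuclideanSpace.norm_eq]

theorem norm_polarPoint_sub {r : ℝ} (hr : 0 ≤ r) (θ : ℝ) : ‖polarPoint O r θ - O‖ = r := by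
  rw [polarPoint, add_sub_cancel_left, norm_smul, norm_radial, mul_one, Real.norm_of_nonneg hr]

theorem polarPoint_ne {r : ℝ} (hr : 0 < r) (θ : ℝ) : polarPoint O r θ ≠ O := by
  intro h
  have := norm_polarPoint_sub (O := O) hr.le θ
  rw [h, sub_self, norm_zero] at this
  exact hr.ne this

theorem radial_eq (θ : ℝ) : radial θ = Real.cos θ • e 0 + Real.sin θ • e 1 := by
  ext i
  fin_cases i <;> simp [radial, e]

theorem hasDerivAt_radial (θ : ℝ) :
    HasDerivAt radial (-Real.sin θ • e 0 + Real.cos θ • e 1) θ := by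
  have : radial = fun θ => Real.cos θ • e 0 + Real.sin θ • e 1 := funext radial_eq
  rw [this]
  exact ((Real.hasDerivAt_cos θ).smul_const _).add ((Real.hasDerivAt_sin θ).smul_const _)

theorem continuous_polarPoint : Continuous fun p : ℝ × ℝ => polarPoint O p.1 p.2 := by
  have : Continuous radial := continuous_iff_continuousAt.2 fun θ =>
    (hasDerivAt_radial θ).continuousAt
  unfold polarPoint
  fun_prop

/-- The partial derivatives of a function on the plane. -/
noncomputable def partialDeriv (i : Fin 2) (f : Plane → ℝ) (x : Plane) : ℝ := fderiv ℝ f x (e i)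

theorem hasDerivAt_comp_polarPoint_left {f : Plane → ℝ} {r θ : ℝ}
    (hf : DifferentiableAt ℝ f (polarPoint O r θ)) :
    HasDerivAt (fun r => f (polarPoint O r θ))
      (Real.cos θ * partialDeriv 0 f (polarPoint O r θ) +
        Real.sin θ * partialDeriv 1 f (polarPoint O r θ)) r := by
  have h1 : HasDerivAt (fun r => polarPoint O r θ) (radial θ) r := by
    have h := ((hasDerivAt_id r).smul_const (radial θ)).const_add O
    rw [one_smul] at h
    exact h
  have h2 := hf.hasFDerivAt.comp_hasDerivAt r h1
  rw [radial_eq, map_add, map_smul, map_smul] at h2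
  exact h2

theorem hasDerivAt_comp_polarPoint_right {f : Plane → ℝ} {r θ : ℝ}
    (hf : DifferentiableAt ℝ f (polarPoint O r θ)) :
    HasDerivAt (fun θ => f (polarPoint O r θ))
      (r * (-Real.sin θ * partialDeriv 0 f (polarPoint O r θ) +
        Real.cos θ * partialDeriv 1 f (polarPoint O r θ))) θ := by
  have h1 : HasDerivAt (fun θ => polarPoint O r θ)
      (r • (-Real.sin θ • e 0 + Real.cos θ • e 1)) θ :=
    ((hasDerivAt_radial θ).const_smul r).const_add O
  have h2 := hf.hasFDerivAt.comp_hasDerivAt θ h1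
  rw [map_smul, map_add, map_smul, map_smul] at h2
  exact h2

/-! ### The logarithmic stress function -/

/-- The logarithm is homogeneous only up to an additive term; the factor `1` is the `α` of
`degree_grad_neg`. -/
theorem logStress_smul (D l : ℝ) : ∀ t > 0, ∀ v ≠ 0, logStress O D l (O + t • v) =
    1 * logStress O D l (O + v) + D * l * Real.log t := by
  intro t ht v hv
  simp only [logStress, polarRadius, add_sub_cancel_left]
  rw [norm_smul, Real.norm_of_nonneg ht.le, Real.log_mul ht.ne' (norm_ne_zero_iff.2 hv)]
  ring

theorem contDiffOn_logStress (D l : ℝ) : ContDiffOn ℝ ∞ (logStress O D l) {O}ᶜ := by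
  intro x hx
  have hx' : x - O ≠ 0 := sub_ne_zero.2 hx
  refine ContDiffAt.contDiffWithinAt ?_
  refine contDiffAt_const.mul (ContDiffAt.log ?_ (norm_ne_zero_iff.2 hx'))
  exact (contDiffAt_id.sub contDiffAt_const).norm ℝ hx'

theorem partialDeriv_logStress (D l : ℝ) {x : Plane} (hx : x ≠ O) (i : Fin 2) :
    partialDeriv i (logStress O D l) x = D * l * ((x - O) i / ‖x - O‖ ^ 2) := by
  have hx' : x - O ≠ 0 := sub_ne_zero.2 hx
  have h0 : ‖x - O‖ ^ 2 ≠ 0 := pow_ne_zero 2 (norm_ne_zero_iff.2 hx')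
  have h1 : logStress O D l = fun x => D * l / 2 * Real.log (‖x - O‖ ^ 2) := by
    funext y
    rw [Real.log_pow, logStress, polarRadius]
    push_cast
    ring
  have h2 : HasFDerivAt (fun x : Plane => ‖x - O‖ ^ 2) _ x :=
    ((hasFDerivAt_id x).sub_const O).norm_sq
  have h3 := ((h2.log h0).const_mul (D * l / 2)).fderiv
  rw [partialDeriv, h1, h3]
  simp [e, EuclideanSpace.inner_single_right]
  field_simp

theorem locallyIntegrable_logStress (D l : ℝ) : LocallyIntegrable (logStress O D l) := by
  refine locallyIntegrable_of_norm_le (C := |D * l|) (contDiffOn_logStress D l).continuousOn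
    fun x hx => ?_
  have h0 : 0 < ‖x - O‖ := norm_pos_iff.2 (sub_ne_zero.2 hx)
  rw [logStress, abs_mul]
  gcongr
  rw [polarRadius, abs_le]
  -- Applied to `r` and to `1 / r`, this bounds `|log r|` by `r + 1 / r`.
  have h1 := Real.log_le_sub_one_of_pos h0
  have h2 := Real.log_le_sub_one_of_pos (inv_pos.2 h0)
  rw [Real.log_inv] at h2
  have h3 := inv_pos.2 h0
  constructor <;> linarith

/-! ### The conical deformation -/

/-- A periodic function `a sin (μ θ)` is of the form `a' sin (n θ)` with a natural number `n`,
where `n² = μ²` unless the function is zero. -/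
theorem exists_nat_frequency {a μ : ℝ} {g : ℝ → ℝ} (hg : ∀ θ, g θ = a * Real.sin (μ * θ))
    (hper : Function.Periodic g (2 * Real.pi)) :
    ∃ (a' : ℝ) (n : ℕ), (∀ θ, g θ = a' * Real.sin (n * θ)) ∧
      a' * (μ ^ 2 - 1) = a' * ((n : ℝ) ^ 2 - 1) := by
  by_cases ha : a = 0
  -- When `g = 0` the number `μ` may be arbitrary, so `μ² - 1 = n² - 1` is available only after
  -- multiplication by the amplitude.
  · exact ⟨0, 0, fun θ => by simp [hg, ha], by simp⟩
  by_cases hμ : μ = 0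
  · exact ⟨0, 0, fun θ => by simp [hg, hμ], by simp⟩
  have h1 : ∀ θ, Real.sin (μ * (θ + 2 * Real.pi)) = Real.sin (μ * θ) := fun θ => by
    have := hper θ
    rw [hg, hg] at this
    exact mul_left_cancel₀ ha this
  have h2 : Real.sin (μ * (2 * Real.pi)) = 0 := by simpa using h1 0
  have h3 : Real.cos (μ * (2 * Real.pi)) = 1 := by
    -- Here `sin (μ θ) = 1`, so the addition formula isolates `cos (2πμ)`.
    have := h1 (Real.pi / 2 / μ)
    rwa [mul_add, mul_div_cancel₀ _ hμ, Real.sin_add, h2, Real.sin_pi_div_two, mul_zero, one_mul,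
      add_zero] at this
  obtain ⟨k, hk⟩ := (Real.cos_eq_one_iff _).1 h3
  have hk' : μ = k := by
    have : (2 * Real.pi) ≠ 0 := by positivity
    exact (mul_right_cancel₀ this hk).symm
  obtain ⟨n, rfl | rfl⟩ := k.eq_nat_or_neg
  · refine ⟨a, n, fun θ => by rw [hg, hk']; simp, by rw [hk']; simp⟩
  · refine ⟨-a, n, fun θ => by rw [hg, hk']; simp, by rw [hk']; simp⟩

/-- The position relative to `O` as a complex number. -/
noncomputable def toComplex (O x : Plane) : ℂ := ⟨x 0 - O 0, x 1 - O 1⟩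

theorem norm_toComplex (O x : Plane) : ‖toComplex O x‖ = ‖x - O‖ := by
  rw [Complex.norm_def, EuclideanSpace.norm_eq, Complex.normSq_apply]
  simp [toComplex, sq]

theorem contDiff_toComplex : ContDiff ℝ ∞ (toComplex O) := by
  have : toComplex O = fun x =>
      Complex.ofRealCLM (x 0 - O 0) + Complex.ofRealCLM (x 1 - O 1) * Complex.I := by
    funext x
    apply Complex.ext <;> simp [toComplex]
  rw [this]
  have h : ∀ i : Fin 2, ContDiff ℝ ∞ fun x : Plane => x i - O i := fun i => by fun_prop
  exact (Complex.ofRealCLM.contDiff.comp (h 0)).add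
    ((Complex.ofRealCLM.contDiff.comp (h 1)).mul contDiff_const)

/-- De Moivre. The left side avoids the branch cut of `arg`, which is how an integer frequency makes
the cone smooth off `O`. -/
theorem im_unit_pow (z : ℂ) (n : ℕ) :
    ‖z‖ * ((z * (‖z‖⁻¹ : ℝ)) ^ n).im = ‖z‖ * Real.sin (n * z.arg) := by
  rcases eq_or_ne z 0 with rfl | hz
  · simp
  have h1 : z * (‖z‖⁻¹ : ℝ) = Complex.exp (z.arg * Complex.I) := by
    have h2 := Complex.norm_mul_exp_arg_mul_I z
    have h3 : (‖z‖ : ℂ) ≠ 0 := by exact_mod_cast norm_ne_zero_iff.2 hz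
    nth_rewrite 1 [← h2]
    push_cast
    field_simp
  rw [h1, ← Complex.exp_nat_mul, ← mul_assoc]
  have : (n : ℂ) * (z.arg : ℂ) = ((n * z.arg : ℝ) : ℂ) := by push_cast; rfl
  rw [this, Complex.exp_ofReal_mul_I_im]

theorem cone_smul (g : ℝ → ℝ) {t : ℝ} (ht : 0 < t) (v : Plane) :
    cone O g (O + t • v) = t * cone O g (O + v) := by
  rw [cone, cone, polarRadius, polarRadius, add_sub_cancel_left, add_sub_cancel_left, norm_smul,
    Real.norm_of_nonneg ht.le]
  have : polarAngle O (O + t • v) = polarAngle O (O + v) := by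
    rw [polarAngle, polarAngle, ← Complex.arg_real_mul ⟨(O + v) 0 - O 0, (O + v) 1 - O 1⟩ ht]
    congr 1
    apply Complex.ext <;> simp
  rw [this, mul_assoc]

section Cone

variable {a : ℝ} {n : ℕ} {g : ℝ → ℝ} (hg : ∀ θ, g θ = a * Real.sin (n * θ))
include hg

theorem cone_eq (x : Plane) :
    cone O g x = a * (‖x - O‖ * ((toComplex O x * (‖x - O‖⁻¹ : ℝ)) ^ n).im) := by
  have h := im_unit_pow (toComplex O x) n
  rw [norm_toComplex] at h
  rw [h, cone, hg, polarRadius, polarAngle, toComplex]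
  ring

theorem contDiffOn_cone : ContDiffOn ℝ ∞ (cone O g) {O}ᶜ := by
  have : cone O g = fun x => a * (‖x - O‖ * Complex.imCLM
      ((toComplex O x * Complex.ofRealCLM ‖x - O‖⁻¹) ^ n)) := funext (cone_eq hg)
  rw [this]
  intro x hx
  have hx' : x - O ≠ 0 := sub_ne_zero.2 hx
  refine ContDiffAt.contDiffWithinAt ?_
  have h1 : ContDiffAt ℝ ∞ (fun x => ‖x - O‖) x := (contDiffAt_id.sub contDiffAt_const).norm ℝ hx'
  have h2 : ContDiffAt ℝ ∞ (fun x => ‖x - O‖⁻¹) x := h1.inv (norm_ne_zero_iff.2 hx')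
  exact contDiffAt_const.mul (h1.mul (Complex.imCLM.contDiff.contDiffAt.comp x
    ((contDiff_toComplex.contDiffAt.mul (Complex.ofRealCLM.contDiff.contDiffAt.comp x h2)).pow n)))

/-- Valid for every real `θ`, not just for principal arguments, so it can be differentiated in `θ`
across the cut. -/
theorem cone_polarPoint {r : ℝ} (hr : 0 < r) (θ : ℝ) : cone O g (polarPoint O r θ) = r * g θ := by
  have h1 : toComplex O (polarPoint O r θ) * (r⁻¹ : ℝ) = Complex.exp (θ * Complex.I) := by
    have h2 : toComplex O (polarPoint O r θ) = r * Complex.exp (θ * Complex.I) := by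
      apply Complex.ext
      · simp [toComplex, polarPoint_apply_zero, Complex.exp_ofReal_mul_I_re]
      · simp [toComplex, polarPoint_apply_one, Complex.exp_ofReal_mul_I_im]
    have h3 : (r : ℂ) ≠ 0 := by exact_mod_cast hr.ne'
    rw [h2]
    push_cast
    field_simp
  rw [cone_eq hg, norm_polarPoint_sub hr.le, h1, ← Complex.exp_nat_mul, ← mul_assoc (n : ℂ)]
  have : (n : ℂ) * (θ : ℂ) = ((n * θ : ℝ) : ℂ) := by push_cast; rfl
  rw [this, Complex.exp_ofReal_mul_I_im, hg]
  ring

theorem differentiableAt_cone {x : Plane} (hx : x ≠ O) : DifferentiableAt ℝ (cone O g) x :=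
  ((contDiffOn_cone hg).contDiffAt (isOpen_compl_singleton.mem_nhds hx)).differentiableAt
    (by simp)

/-- The radial derivative is `g` and the angular one, divided by `r`, is `g'`; rotating this frame
back gives `∇w = g e_r + g' e_θ`, free of `r`. -/
theorem partialDeriv_cone {r : ℝ} (hr : 0 < r) (θ : ℝ) :
    partialDeriv 0 (cone O g) (polarPoint O r θ) =
        g θ * Real.cos θ - a * n * Real.cos (n * θ) * Real.sin θ ∧
      partialDeriv 1 (cone O g) (polarPoint O r θ) =
        g θ * Real.sin θ + a * n * Real.cos (n * θ) * Real.cos θ := by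
  have hd := differentiableAt_cone hg (polarPoint_ne (O := O) hr θ)
  have h1 : HasDerivAt (fun r => cone O g (polarPoint O r θ)) (g θ) r := by
    have h2 : HasDerivAt (fun r => r * g θ) (g θ) r := by
      simpa using (hasDerivAt_id r).mul_const (g θ)
    refine h2.congr_of_eventuallyEq ?_
    filter_upwards [lt_mem_nhds hr] with r hr
    exact cone_polarPoint hg hr θ
  have h2 : HasDerivAt (fun θ => cone O g (polarPoint O r θ))
      (r * (a * n * Real.cos (n * θ))) θ := by
    have h3 : (fun θ => cone O g (polarPoint O r θ)) = fun θ => r * (a * Real.sin (n * θ)) :=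
      funext fun θ => by rw [cone_polarPoint hg hr, hg]
    rw [h3]
    have h4 := ((((hasDerivAt_id θ).const_mul (n : ℝ)).sin).const_mul a).const_mul r
    refine h4.congr_deriv ?_
    simp only [id, mul_one]
    ring
  have e1 := (hasDerivAt_comp_polarPoint_left hd).unique h1
  have e2 := mul_left_cancel₀ hr.ne' ((hasDerivAt_comp_polarPoint_right hd).unique h2)
  have e3 := Real.sin_sq_add_cos_sq θ
  set p := partialDeriv 0 (cone O g) (polarPoint O r θ)
  set q := partialDeriv 1 (cone O g) (polarPoint O r θ)
  constructor
  · linear_combination Real.cos θ * e1 - Real.sin θ * e2 - p * e3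
  · linear_combination Real.sin θ * e1 + Real.cos θ * e2 - q * e3

/-- Differentiate `w(O + t v) = t w(O + v)` in `v` and cancel `t`. -/
theorem partialDeriv_cone_smul {t : ℝ} (ht : 0 < t) {v : Plane} (hv : v ≠ 0) (i : Fin 2) :
    partialDeriv i (cone O g) (O + t • v) = partialDeriv i (cone O g) (O + v) := by
  have h1 : HasFDerivAt (fun v : Plane => O + t • v) (t • ContinuousLinearMap.id ℝ Plane) v :=
    ((hasFDerivAt_id v).const_smul t).const_add O
  have h2 : HasFDerivAt (fun v : Plane => O + v) (ContinuousLinearMap.id ℝ Plane) v :=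
    (hasFDerivAt_id v).const_add O
  have d1 := (differentiableAt_cone (O := O) hg (x := O + t • v)
    (by simpa [ht.ne'] using hv)).hasFDerivAt.comp v h1
  have d2 := ((differentiableAt_cone (O := O) hg (x := O + v)
    (by simpa using hv)).hasFDerivAt.comp v h2).const_mul t
  have h3 : (cone O g ∘ fun v => O + t • v) = fun v => t * (cone O g ∘ fun v => O + v) v :=
    funext fun v => cone_smul g ht v
  rw [h3] at d1
  have h4 := congrArg (fun L => L (e i)) (d1.unique d2)
  simp only [ContinuousLinearMap.comp_apply, smul_apply, map_smul,
    ContinuousLinearMap.id_apply, smul_eq_mul] at h4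
  exact mul_left_cancel₀ ht.ne' h4

theorem locallyIntegrable_cone : LocallyIntegrable (cone O g) := by
  refine locallyIntegrable_of_norm_le (C := |a|) (contDiffOn_cone hg).continuousOn fun x _ => ?_
  rw [cone, hg, polarRadius, abs_mul, abs_mul, abs_norm]
  calc _ ≤ ‖x - O‖ * (|a| * 1) := by
        gcongr
        exact Real.abs_sin_le_one _
    _ = |a| * ‖x - O‖ := by ring
    _ ≤ _ := by
      gcongr
      exact le_add_of_nonneg_left (by positivity)

theorem continuousOn_dyad (D l : ℝ) (p : Fin 2 × Fin 2) :
    ContinuousOn (fun x => fderiv ℝ (logStress O D l) x (e p.1) * fderiv ℝ (cone O g) x (e p.2))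
      {O}ᶜ :=
  (((contDiffOn_logStress D l).continuousOn_fderiv_of_isOpen isOpen_compl_singleton
    (by simp)).clm_apply continuousOn_const).mul
    (((contDiffOn_cone hg).continuousOn_fderiv_of_isOpen isOpen_compl_singleton
    (by simp)).clm_apply continuousOn_const)

theorem dyad_smul (D l : ℝ) (p : Fin 2 × Fin 2) : ∀ t > 0, ∀ v ≠ 0,
    fderiv ℝ (logStress O D l) (O + t • v) (e p.1) * fderiv ℝ (cone O g) (O + t • v) (e p.2) =
      t⁻¹ * (fderiv ℝ (logStress O D l) (O + v) (e p.1) *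
        fderiv ℝ (cone O g) (O + v) (e p.2)) := by
  intro t ht v hv
  have h1 := partialDeriv_cone_smul hg ht hv (O := O) p.2
  have h2 := partialDeriv_logStress D l (O := O) (x := O + t • v)
    (by simpa [ht.ne'] using hv) p.1
  have h3 := partialDeriv_logStress D l (O := O) (x := O + v) (by simpa using hv) p.1
  unfold partialDeriv at h1 h2 h3
  have h4 : ‖v‖ ≠ 0 := norm_ne_zero_iff.2 hv
  rw [h1, h2, h3, add_sub_cancel_left, add_sub_cancel_left, norm_smul, Real.norm_of_nonneg ht.le,
    PiLp.smul_apply, smul_eq_mul]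
  field_simp

end Cone

/-! ### Integration in polar coordinates -/

theorem integral_swap_of_continuous {G : ℝ → ℝ → ℝ} (hG : Continuous fun p : ℝ × ℝ => G p.1 p.2)
    (a b c d : ℝ) : ∫ θ in c..d, ∫ r in a..b, G r θ = ∫ r in a..b, ∫ θ in c..d, G r θ := by
  refine (intervalIntegral_intervalIntegral_swap ?_).symm
  exact (hG.continuousOn.integrableOn_compact (isCompact_uIcc.prod isCompact_uIcc)).mono_set
    (Set.prod_mono Set.uIoc_subset_uIcc Set.uIoc_subset_uIcc)

theorem continuous_integral_of_continuous {G : ℝ → ℝ → ℝ}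
    (hG : Continuous fun p : ℝ × ℝ => G p.1 p.2) (a b : ℝ) :
    Continuous fun θ => ∫ r in a..b, G r θ := by
  refine intervalIntegral.continuous_parametric_intervalIntegral_of_continuous'
    (f := fun θ r => G r θ) ?_ a b
  exact hG.comp continuous_swap

theorem integral_eq_integral_prod (F : Plane → ℝ) :
    ∫ x, F x = ∫ p : ℝ × ℝ, F (O + !₂[p.1, p.2]) := by
  have h1 := (volume_preserving_finTwoArrow ℝ).symm
  have h2 := (EuclideanSpace.volume_preserving_symm_measurableEquiv_toLp (Fin 2)).symm
  rw [← integral_add_left_eq_self F O, ← h2.integral_comp (MeasurableEquiv.measurableEmbedding _),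
    ← h1.integral_comp (MeasurableEquiv.measurableEmbedding _)]
  rfl

/-- Integration in polar coordinates of a function that vanishes outside of a disc, where `G` is a
continuous extension of the integrand `r F`. -/
theorem integral_eq_polar {F : Plane → ℝ} {R : ℝ} (hR : 0 ≤ R)
    (hF : ∀ x, R < ‖x - O‖ → F x = 0) {G : ℝ → ℝ → ℝ}
    (hG : Continuous fun p : ℝ × ℝ => G p.1 p.2)
    (h : ∀ r > 0, ∀ θ ∈ Set.Ioo (-Real.pi) Real.pi, r * F (polarPoint O r θ) = G r θ) :
    ∫ x, F x = ∫ θ in -Real.pi..Real.pi, ∫ r in 0..R, G r θ := by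
  have hpi : -Real.pi ≤ Real.pi := by linarith [Real.pi_pos]
  rw [integral_eq_integral_prod (O := O), ← integral_comp_polarCoord_symm]
  have h1 : ∀ p ∈ polarCoord.target,
      p.1 • F (O + !₂[(polarCoord.symm p).1, (polarCoord.symm p).2]) = G p.1 p.2 := by
    rintro ⟨r, θ⟩ hp
    rw [polarCoord_target] at hp
    rw [← h r hp.1 θ hp.2, smul_eq_mul]
    congr 2
    ext i
    fin_cases i <;> simp [polarPoint, radial]
  rw [setIntegral_congr_fun polarCoord.open_target.measurableSet h1, polarCoord_target]
  -- Restricting to `r ≤ R` gives a bounded rectangle, on which continuity of `G` up to `r = 0`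
  -- justifies Fubini.
  have h2 : ∫ p in Set.Ioi (0 : ℝ) ×ˢ Set.Ioo (-Real.pi) Real.pi, G p.1 p.2 =
      ∫ p in Set.Ioc 0 R ×ˢ Set.Ioo (-Real.pi) Real.pi, G p.1 p.2 := by
    refine setIntegral_eq_of_subset_of_forall_sdiff_eq_zero
      (measurableSet_Ioi.prod measurableSet_Ioo)
      (Set.prod_mono Set.Ioc_subset_Ioi_self subset_rfl) ?_
    rintro ⟨r, θ⟩ ⟨⟨hr, hθ⟩, hn⟩
    have hr' : R < r := by
      by_contra hc
      exact hn ⟨⟨hr, not_lt.1 hc⟩, hθ⟩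
    rw [← h r hr θ hθ, hF _ (by rwa [norm_polarPoint_sub (le_of_lt hr)]), mul_zero]
  have hint : IntegrableOn (fun p : ℝ × ℝ => G p.1 p.2)
      (Set.Ioc 0 R ×ˢ Set.Ioc (-Real.pi) Real.pi) := by
    refine (hG.continuousOn.integrableOn_compact (isCompact_Icc.prod isCompact_Icc)).mono_set
      (Set.prod_mono (Set.Ioc_subset_Icc_self (a := 0) (b := R))
        (Set.Ioc_subset_Icc_self (a := -Real.pi) (b := Real.pi)))
  rw [h2, Measure.volume_eq_prod, setIntegral_prod _
    (hint.mono_set (Set.prod_mono subset_rfl Set.Ioo_subset_Ioc_self))]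
  rw [integral_swap_of_continuous hG, intervalIntegral.integral_of_le hR]
  refine setIntegral_congr_fun measurableSet_Ioc fun r _ => ?_
  simp only
  rw [intervalIntegral.integral_of_le hpi, integral_Ioc_eq_integral_Ioo]

theorem integral_polar_add {F G : ℝ → ℝ → ℝ} (hF : Continuous fun p : ℝ × ℝ => F p.1 p.2)
    (hG : Continuous fun p : ℝ × ℝ => G p.1 p.2) (a b c d : ℝ) :
    ∫ θ in c..d, ∫ r in a..b, (F r θ + G r θ) =
      (∫ θ in c..d, ∫ r in a..b, F r θ) + ∫ θ in c..d, ∫ r in a..b, G r θ := by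
  rw [← intervalIntegral.integral_add
    ((continuous_integral_of_continuous hF a b).intervalIntegrable _ _)
    ((continuous_integral_of_continuous hG a b).intervalIntegrable _ _)]
  congr 1
  funext θ
  exact intervalIntegral.integral_add
    ((hF.comp (Continuous.prodMk_left θ)).intervalIntegrable _ _)
    ((hG.comp (Continuous.prodMk_left θ)).intervalIntegrable _ _)

/-! ### Partial derivatives of test functions -/

theorem contDiff_partialDeriv {χ : Plane → ℝ} (h : ContDiff ℝ ∞ χ) (i : Fin 2) :
    ContDiff ℝ ∞ (partialDeriv i χ) :=
  (h.fderiv_right (m := ∞) (by simp)).clm_apply contDiff_const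

theorem notMem_tsupport_partialDeriv {χ : Plane → ℝ} {x : Plane} (hx : x ∉ tsupport χ)
    (i : Fin 2) : x ∉ tsupport (partialDeriv i χ) :=
  fun h => hx (tsupport_fderiv_apply_subset ℝ (e i) h)

theorem partialDeriv_comm {χ : Plane → ℝ} (h : ContDiff ℝ ∞ χ) (x : Plane) (i j : Fin 2) :
    partialDeriv i (partialDeriv j χ) x = partialDeriv j (partialDeriv i χ) x := by
  have hs : IsSymmSndFDerivAt ℝ χ x := h.contDiffAt.isSymmSndFDerivAt (by
    rw [minSmoothness_of_isRCLikeNormedField]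
    exact WithTop.coe_le_coe.2 (le_top (a := (2 : ℕ∞))))
  have hd : DifferentiableAt ℝ (fderiv ℝ χ) x :=
    ((h.fderiv_right (m := ∞) (by simp)).differentiable (by simp)).differentiableAt
  have h1 : ∀ i j : Fin 2, partialDeriv i (partialDeriv j χ) x =
      fderiv ℝ (fderiv ℝ χ) x (e i) (e j) := fun i j => by
    have := (hd.hasFDerivAt.clm_apply (hasFDerivAt_const (e j) x)).fderiv
    change fderiv ℝ (fun y => fderiv ℝ χ y (e j)) x (e i) = _
    rw [this]
    simp
  rw [h1, h1, hs.eq]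

theorem polarPoint_neg_pi (r : ℝ) : polarPoint O r (-Real.pi) = polarPoint O r Real.pi := by
  ext i
  fin_cases i <;> simp [polarPoint, radial]

/-! ### The Laplacian of the cone and the circular mean of its gradient -/

section Identity

variable {a : ℝ} {n : ℕ} {g : ℝ → ℝ} (hg : ∀ θ, g θ = a * Real.sin (n * θ))
include hg

theorem hasDerivAt_profile (θ : ℝ) : HasDerivAt g (a * n * Real.cos (n * θ)) θ := by
  have : g = fun θ => a * Real.sin (n * θ) := funext hg
  rw [this]
  refine ((((hasDerivAt_id θ).const_mul (n : ℝ)).sin).const_mul a).congr_deriv ?_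
  simp only [id, mul_one]
  ring

omit hg in
theorem hasDerivAt_profile_deriv (a : ℝ) (n : ℕ) (θ : ℝ) :
    HasDerivAt (fun θ => a * n * Real.cos (n * θ)) (-(n ^ 2 * (a * Real.sin (n * θ)))) θ := by
  refine ((((hasDerivAt_id θ).const_mul (n : ℝ)).cos).const_mul (a * n)).congr_deriv ?_
  simp only [id, mul_one]
  ring

theorem continuous_profile : Continuous g := by
  have : g = fun θ => a * Real.sin (n * θ) := funext hg
  rw [this]
  fun_prop

/-- In the sense of distributions, `Δ (r g(θ)) = (g + g'') / r`. -/
theorem integral_cone_mul_laplacian {χ : Plane → ℝ} (hχ : ContDiff ℝ ∞ χ) {R : ℝ} (hR : 0 ≤ R)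
    (hs : ∀ x, R ≤ ‖x - O‖ → x ∉ tsupport χ) :
    ∫ x, cone O g x * (partialDeriv 0 (partialDeriv 0 χ) x + partialDeriv 1 (partialDeriv 1 χ) x) =
      ∫ θ in -Real.pi..Real.pi, ∫ r in 0..R, (1 - (n : ℝ) ^ 2) * g θ * χ (polarPoint O r θ) := by
  have hgc := continuous_profile hg
  have hP : Continuous fun p : ℝ × ℝ => polarPoint O p.1 p.2 := continuous_polarPoint
  have hχ1 := contDiff_partialDeriv hχ
  have hχ2 := fun i j => contDiff_partialDeriv (hχ1 i) j
  have hd : ∀ {f : Plane → ℝ}, ContDiff ℝ ∞ f → ∀ x, DifferentiableAt ℝ f x :=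
    fun hf x => (hf.differentiable (by simp)).differentiableAt
  have hz1 : ∀ i x, R ≤ ‖x - O‖ → partialDeriv i χ x = 0 := fun i x hx =>
    image_eq_zero_of_notMem_tsupport (notMem_tsupport_partialDeriv (hs x hx) i)
  have hz2 : ∀ i j x, R ≤ ‖x - O‖ → partialDeriv j (partialDeriv i χ) x = 0 := fun i j x hx =>
    image_eq_zero_of_notMem_tsupport (notMem_tsupport_partialDeriv
      (notMem_tsupport_partialDeriv (hs x hx) i) j)
  -- Here `A = g (r² χ_r - r χ)` and `B = g χ_θ - g' χ`, with `A' = ∂_r A` and `B' = ∂_θ B`. They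
  -- are chosen so that `r² g Δχ = A' + B' + (g + g'') χ`. `A` vanishes at `r = 0` and `r = R`, and
  -- `B` agrees at `θ = ±π`.
  let A : ℝ → ℝ → ℝ := fun r θ => g θ * (r ^ 2 * (Real.cos θ * partialDeriv 0 χ (polarPoint O r θ) +
    Real.sin θ * partialDeriv 1 χ (polarPoint O r θ)) - r * χ (polarPoint O r θ))
  let A' : ℝ → ℝ → ℝ := fun r θ => g θ * (r ^ 2 *
      (Real.cos θ * (Real.cos θ * partialDeriv 0 (partialDeriv 0 χ) (polarPoint O r θ) +
          Real.sin θ * partialDeriv 1 (partialDeriv 0 χ) (polarPoint O r θ)) +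
        Real.sin θ * (Real.cos θ * partialDeriv 0 (partialDeriv 1 χ) (polarPoint O r θ) +
          Real.sin θ * partialDeriv 1 (partialDeriv 1 χ) (polarPoint O r θ))) +
      r * (Real.cos θ * partialDeriv 0 χ (polarPoint O r θ) +
        Real.sin θ * partialDeriv 1 χ (polarPoint O r θ)) - χ (polarPoint O r θ))
  let B : ℝ → ℝ → ℝ := fun r θ => g θ * (r * (-Real.sin θ * partialDeriv 0 χ (polarPoint O r θ) +
    Real.cos θ * partialDeriv 1 χ (polarPoint O r θ))) -
    a * n * Real.cos (n * θ) * χ (polarPoint O r θ)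
  let B' : ℝ → ℝ → ℝ := fun r θ => g θ * (r * (-Real.sin θ *
      (r * (-Real.sin θ * partialDeriv 0 (partialDeriv 0 χ) (polarPoint O r θ) +
        Real.cos θ * partialDeriv 1 (partialDeriv 0 χ) (polarPoint O r θ))) -
      Real.cos θ * partialDeriv 0 χ (polarPoint O r θ) +
      Real.cos θ * (r * (-Real.sin θ * partialDeriv 0 (partialDeriv 1 χ) (polarPoint O r θ) +
        Real.cos θ * partialDeriv 1 (partialDeriv 1 χ) (polarPoint O r θ))) -
      Real.sin θ * partialDeriv 1 χ (polarPoint O r θ))) +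
    (n : ℝ) ^ 2 * g θ * χ (polarPoint O r θ)
  have hA : ∀ r θ, HasDerivAt (fun r => A r θ) (A' r θ) r := by
    intro r θ
    have d0 := hasDerivAt_comp_polarPoint_left (θ := θ) (hd hχ (polarPoint O r θ))
    have d1 := fun i => hasDerivAt_comp_polarPoint_left (θ := θ) (hd (hχ1 i) (polarPoint O r θ))
    refine (((((hasDerivAt_id r).pow 2).mul (((d1 0).const_mul (Real.cos θ)).add
      ((d1 1).const_mul (Real.sin θ)))).sub ((hasDerivAt_id r).mul d0)).const_mul
      (g θ)).congr_deriv ?_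
    simp only [A', id, Nat.cast_ofNat, Nat.add_one_sub_one, pow_one, mul_one, one_mul, Pi.add_apply,
      Pi.pow_apply]
    ring
  have hB : ∀ r θ, HasDerivAt (fun θ => B r θ) (B' r θ) θ := by
    intro r θ
    have d0 := hasDerivAt_comp_polarPoint_right (θ := θ) (hd hχ (polarPoint O r θ))
    have d1 := fun i => hasDerivAt_comp_polarPoint_right (θ := θ) (hd (hχ1 i) (polarPoint O r θ))
    refine (((hasDerivAt_profile hg θ).mul ((((Real.hasDerivAt_sin θ).neg.mul (d1 0)).add
      ((Real.hasDerivAt_cos θ).mul (d1 1))).const_mul r)).sub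
      ((hasDerivAt_profile_deriv a n θ).mul d0)).congr_deriv ?_
    simp only [B', hg θ, Pi.neg_apply, Pi.mul_apply, Pi.add_apply]
    ring
  have hA'c : Continuous fun p : ℝ × ℝ => A' p.1 p.2 := by
    fun_prop
  have hB'c : Continuous fun p : ℝ × ℝ => B' p.1 p.2 := by
    fun_prop
  have hCc : Continuous fun p : ℝ × ℝ => (1 - (n : ℝ) ^ 2) * g p.2 * χ (polarPoint O p.1 p.2) := by
    fun_prop
  have hAint : ∫ θ in -Real.pi..Real.pi, ∫ r in 0..R, A' r θ = 0 := by
    have : ∀ θ, ∫ r in 0..R, A' r θ = 0 := fun θ => by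
      rw [intervalIntegral.integral_eq_sub_of_hasDerivAt (fun r _ => hA r θ)
        ((hA'c.comp (Continuous.prodMk_left θ)).intervalIntegrable _ _)]
      have hn : R ≤ ‖polarPoint O R θ - O‖ := (norm_polarPoint_sub hR θ).ge
      simp [A, hz1 _ _ hn, image_eq_zero_of_notMem_tsupport (hs _ hn)]
    simp [this]
  have hBint : ∫ θ in -Real.pi..Real.pi, ∫ r in 0..R, B' r θ = 0 := by
    rw [integral_swap_of_continuous hB'c]
    have : ∀ r, ∫ θ in -Real.pi..Real.pi, B' r θ = 0 := fun r => by
      rw [intervalIntegral.integral_eq_sub_of_hasDerivAt (fun θ _ => hB r θ)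
        ((hB'c.comp (Continuous.prodMk_right r)).intervalIntegrable _ _)]
      simp [B, hg, polarPoint_neg_pi]
    simp [this]
  have hsum : ∀ r > 0, ∀ θ ∈ Set.Ioo (-Real.pi) Real.pi,
      r * (cone O g (polarPoint O r θ) * (partialDeriv 0 (partialDeriv 0 χ) (polarPoint O r θ) +
        partialDeriv 1 (partialDeriv 1 χ) (polarPoint O r θ))) =
      A' r θ + (B' r θ + (1 - (n : ℝ) ^ 2) * g θ * χ (polarPoint O r θ)) := by
    intro r hr θ _
    have hsc := Real.sin_sq_add_cos_sq θ
    rw [cone_polarPoint hg hr]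
    simp only [A', B']
    linear_combination (-(r ^ 2 * g θ) * (partialDeriv 0 (partialDeriv 0 χ) (polarPoint O r θ) +
        partialDeriv 1 (partialDeriv 1 χ) (polarPoint O r θ))) * hsc
  rw [integral_eq_polar (O := O) (R := R) hR (fun x hx => by
    rw [hz2 0 0 x hx.le, hz2 1 1 x hx.le, add_zero, mul_zero])
    (hA'c.add (hB'c.add hCc)) hsum, integral_polar_add hA'c (hB'c.add hCc),
    integral_polar_add hB'c hCc, hAint, hBint, zero_add, zero_add]

/-- The mean over the circle of the gradient of `r a sin (n θ)` vanishes, unless `n = 1`. -/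
theorem integral_grad_cone (p q : ℝ) :
    ∫ θ in -Real.pi..Real.pi, (1 - (n : ℝ) ^ 2) *
      ((g θ * Real.cos θ - a * n * Real.cos (n * θ) * Real.sin θ) * p +
        (g θ * Real.sin θ + a * n * Real.cos (n * θ) * Real.cos θ) * q) = 0 := by
  have hgc := continuous_profile hg
  -- The primitive uses `(g' cos + g sin)' = (1 - n²) g cos` and `(g' sin - g cos)' = (1 - n²) g
  -- sin`. Keeping the factor `1 - n²` avoids division by it and includes `n = 1`.
  have hd : ∀ θ, HasDerivAt (fun θ =>
      (2 * (a * n * Real.cos (n * θ) * Real.cos θ + g θ * Real.sin θ) -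
        (1 - (n : ℝ) ^ 2) * (g θ * Real.sin θ)) * p +
      (2 * (a * n * Real.cos (n * θ) * Real.sin θ - g θ * Real.cos θ) +
        (1 - (n : ℝ) ^ 2) * (g θ * Real.cos θ)) * q)
      ((1 - (n : ℝ) ^ 2) *
      ((g θ * Real.cos θ - a * n * Real.cos (n * θ) * Real.sin θ) * p +
        (g θ * Real.sin θ + a * n * Real.cos (n * θ) * Real.cos θ) * q)) θ := by
    intro θ
    have h1 := hasDerivAt_profile hg θ
    have h2 := hasDerivAt_profile_deriv a n θ
    have hsin := Real.hasDerivAt_sin θ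
    have hcos := Real.hasDerivAt_cos θ
    refine (((((h2.mul hcos).add (h1.mul hsin)).const_mul 2).sub
      ((h1.mul hsin).const_mul (1 - (n : ℝ) ^ 2))).mul_const p |>.add
      (((((h2.mul hsin).sub (h1.mul hcos)).const_mul 2).add
      ((h1.mul hcos).const_mul (1 - (n : ℝ) ^ 2))).mul_const q)).congr_deriv ?_
    rw [hg θ]
    ring
  rw [intervalIntegral.integral_eq_sub_of_hasDerivAt (fun θ _ => hd θ)
    (Continuous.intervalIntegrable (by fun_prop) _ _)]
  simp [hg]

end Identity

/-! ### Cancellation of the bending and stress terms -/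

section Balance

variable {a : ℝ} {n : ℕ} {g : ℝ → ℝ} (hg : ∀ θ, g θ = a * Real.sin (n * θ))
include hg

/-- The integral of `∇φ ⊗ ∇w` against the cofactor of the Hessian of `ψ`, in polar coordinates. -/
theorem integral_dyad_mul_cofactor (D l : ℝ) {ψ : Plane → ℝ} (hψ : ContDiff ℝ ∞ ψ) {R : ℝ}
    (hR : 0 ≤ R) (hs : ∀ x, R ≤ ‖x - O‖ → x ∉ tsupport ψ) :
    ∫ x, (partialDeriv 1 (logStress O D l) x * partialDeriv 1 (cone O g) x *
          partialDeriv 0 (partialDeriv 0 ψ) x -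
        (partialDeriv 1 (logStress O D l) x * partialDeriv 0 (cone O g) x +
          partialDeriv 0 (logStress O D l) x * partialDeriv 1 (cone O g) x) *
          partialDeriv 1 (partialDeriv 0 ψ) x +
        partialDeriv 0 (logStress O D l) x * partialDeriv 0 (cone O g) x *
          partialDeriv 1 (partialDeriv 1 ψ) x) =
      ∫ θ in -Real.pi..Real.pi, ∫ r in 0..R, D * l * (
        Real.sin θ * (g θ * Real.sin θ + a * n * Real.cos (n * θ) * Real.cos θ) *
          partialDeriv 0 (partialDeriv 0 ψ) (polarPoint O r θ) -
        (Real.sin θ * (g θ * Real.cos θ - a * n * Real.cos (n * θ) * Real.sin θ) +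
          Real.cos θ * (g θ * Real.sin θ + a * n * Real.cos (n * θ) * Real.cos θ)) *
          partialDeriv 1 (partialDeriv 0 ψ) (polarPoint O r θ) +
        Real.cos θ * (g θ * Real.cos θ - a * n * Real.cos (n * θ) * Real.sin θ) *
          partialDeriv 1 (partialDeriv 1 ψ) (polarPoint O r θ)) := by
  have hz2 : ∀ i j x, R ≤ ‖x - O‖ → partialDeriv j (partialDeriv i ψ) x = 0 := fun i j x hx =>
    image_eq_zero_of_notMem_tsupport (notMem_tsupport_partialDeriv
      (notMem_tsupport_partialDeriv (hs x hx) i) j)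
  refine integral_eq_polar (O := O) hR (fun x hx => by simp [hz2 _ _ x hx.le]) ?_ fun r hr θ _ => ?_
  · have hψ2 := fun i j => contDiff_partialDeriv (contDiff_partialDeriv hψ i) j
    have hP : Continuous fun p : ℝ × ℝ => polarPoint O p.1 p.2 := continuous_polarPoint
    have hgc := continuous_profile hg
    fun_prop
  · rw [partialDeriv_logStress D l (polarPoint_ne hr θ), partialDeriv_logStress D l
      (polarPoint_ne hr θ), norm_polarPoint_sub hr.le, (partialDeriv_cone hg hr θ).1,
      (partialDeriv_cone hg hr θ).2, PiLp.sub_apply, PiLp.sub_apply, polarPoint_apply_zero,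
      polarPoint_apply_one, add_sub_cancel_left, add_sub_cancel_left]
    field_simp

/-- The weak form of the equation. With Hessian entries in the polar frame, the bending term gives
`-D l g (ψ_rr + ψ_θθ)` and the stress term `D l (g ψ_θθ - g' ψ_rθ)`. Their sum is an exact radial
derivative. -/
theorem transverse_balance (D : ℝ) {l : ℝ} (hl : a * l = a * ((n : ℝ) ^ 2 - 1)) {ψ : Plane → ℝ}
    (hψ : ContDiff ℝ ∞ ψ) (hc : HasCompactSupport ψ) :
    D * (∫ x, cone O g x * (partialDeriv 0 (partialDeriv 0 fun x =>
          partialDeriv 0 (partialDeriv 0 ψ) x + partialDeriv 1 (partialDeriv 1 ψ) x) x +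
        partialDeriv 1 (partialDeriv 1 fun x =>
          partialDeriv 0 (partialDeriv 0 ψ) x + partialDeriv 1 (partialDeriv 1 ψ) x) x)) +
      ∫ x, (partialDeriv 1 (logStress O D l) x * partialDeriv 1 (cone O g) x *
          partialDeriv 0 (partialDeriv 0 ψ) x -
        (partialDeriv 1 (logStress O D l) x * partialDeriv 0 (cone O g) x +
          partialDeriv 0 (logStress O D l) x * partialDeriv 1 (cone O g) x) *
          partialDeriv 1 (partialDeriv 0 ψ) x +
        partialDeriv 0 (logStress O D l) x * partialDeriv 0 (cone O g) x *
          partialDeriv 1 (partialDeriv 1 ψ) x) = 0 := by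
  obtain ⟨R₀, hR₀⟩ := hc.isBounded.subset_ball O
  let R := max R₀ 0
  have hR : 0 ≤ R := le_max_right _ _
  have hs : ∀ x, R ≤ ‖x - O‖ → x ∉ tsupport ψ := fun x hx hm => by
    have := hR₀ hm
    rw [Metric.mem_ball, dist_eq_norm] at this
    exact absurd (this.trans_le (le_max_left R₀ 0)) (not_lt.2 hx)
  have hψ1 := contDiff_partialDeriv hψ
  have hψ2 := fun i j => contDiff_partialDeriv (hψ1 i) j
  have hχ : ContDiff ℝ ∞ fun x =>
      partialDeriv 0 (partialDeriv 0 ψ) x + partialDeriv 1 (partialDeriv 1 ψ) x :=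
    (hψ2 0 0).add (hψ2 1 1)
  have hsχ : ∀ x, R ≤ ‖x - O‖ → x ∉ tsupport fun x =>
      partialDeriv 0 (partialDeriv 0 ψ) x + partialDeriv 1 (partialDeriv 1 ψ) x :=
    fun x hx hm => by
      have h2 := fun i => notMem_tsupport_partialDeriv
        (notMem_tsupport_partialDeriv (hs x hx) i) i
      exact (tsupport_add _ _ hm).elim (h2 0) (h2 1)
  rw [integral_cone_mul_laplacian hg hχ hR hsχ, integral_dyad_mul_cofactor hg D l hψ hR hs]
  have hgc := continuous_profile hg
  have hc2 : ∀ i j, Continuous fun p : ℝ × ℝ =>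
      partialDeriv j (partialDeriv i ψ) (polarPoint O p.1 p.2) := fun i j =>
    (hψ2 i j).continuous.comp continuous_polarPoint
  rw [← intervalIntegral.integral_const_mul]
  simp_rw [← intervalIntegral.integral_const_mul]
  have hP : Continuous fun p : ℝ × ℝ => polarPoint O p.1 p.2 := continuous_polarPoint
  rw [← integral_polar_add (by fun_prop) (by fun_prop)]
  have hd : ∀ r θ, HasDerivAt (fun r => -(D * l) *
      ((g θ * Real.cos θ - a * n * Real.cos (n * θ) * Real.sin θ) *
          partialDeriv 0 ψ (polarPoint O r θ) +
        (g θ * Real.sin θ + a * n * Real.cos (n * θ) * Real.cos θ) *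
          partialDeriv 1 ψ (polarPoint O r θ)))
      (D * ((1 - (n : ℝ) ^ 2) * g θ * (partialDeriv 0 (partialDeriv 0 ψ) (polarPoint O r θ) +
          partialDeriv 1 (partialDeriv 1 ψ) (polarPoint O r θ))) + D * l * (
        Real.sin θ * (g θ * Real.sin θ + a * n * Real.cos (n * θ) * Real.cos θ) *
          partialDeriv 0 (partialDeriv 0 ψ) (polarPoint O r θ) -
        (Real.sin θ * (g θ * Real.cos θ - a * n * Real.cos (n * θ) * Real.sin θ) +
          Real.cos θ * (g θ * Real.sin θ + a * n * Real.cos (n * θ) * Real.cos θ)) *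
          partialDeriv 1 (partialDeriv 0 ψ) (polarPoint O r θ) +
        Real.cos θ * (g θ * Real.cos θ - a * n * Real.cos (n * θ) * Real.sin θ) *
          partialDeriv 1 (partialDeriv 1 ψ) (polarPoint O r θ))) r := by
    intro r θ
    have d1 := fun i => hasDerivAt_comp_polarPoint_left (r := r) (θ := θ) (O := O)
      ((hψ1 i).differentiable (by simp)).differentiableAt
    refine ((((d1 0).const_mul _).add ((d1 1).const_mul _)).const_mul _).congr_deriv ?_
    have hsc := Real.sin_sq_add_cos_sq θ
    have hlg : (1 - (n : ℝ) ^ 2) * g θ = -(l * g θ) := by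
      rw [hg]
      linear_combination Real.sin (n * θ) * hl
    rw [hlg, partialDeriv_comm hψ _ 0 1]
    linear_combination D * l * g θ * (-partialDeriv 0 (partialDeriv 0 ψ) (polarPoint O r θ) -
      partialDeriv 1 (partialDeriv 1 ψ) (polarPoint O r θ)) * hsc
  -- The end `r = R` contributes nothing; the end `r = 0` leaves `∇w · ∇ψ(O)`, the only place where
  -- a couple at `O` could arise.
  have hint : ∀ θ, ∫ r in 0..R, (D * ((1 - (n : ℝ) ^ 2) * g θ *
          (partialDeriv 0 (partialDeriv 0 ψ) (polarPoint O r θ) +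
          partialDeriv 1 (partialDeriv 1 ψ) (polarPoint O r θ))) + D * l * (
        Real.sin θ * (g θ * Real.sin θ + a * n * Real.cos (n * θ) * Real.cos θ) *
          partialDeriv 0 (partialDeriv 0 ψ) (polarPoint O r θ) -
        (Real.sin θ * (g θ * Real.cos θ - a * n * Real.cos (n * θ) * Real.sin θ) +
          Real.cos θ * (g θ * Real.sin θ + a * n * Real.cos (n * θ) * Real.cos θ)) *
          partialDeriv 1 (partialDeriv 0 ψ) (polarPoint O r θ) +
        Real.cos θ * (g θ * Real.cos θ - a * n * Real.cos (n * θ) * Real.sin θ) *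
          partialDeriv 1 (partialDeriv 1 ψ) (polarPoint O r θ))) =
      -D * ((1 - (n : ℝ) ^ 2) *
      ((g θ * Real.cos θ - a * n * Real.cos (n * θ) * Real.sin θ) * partialDeriv 0 ψ O +
        (g θ * Real.sin θ + a * n * Real.cos (n * θ) * Real.cos θ) * partialDeriv 1 ψ O)) := by
    intro θ
    have hz1 : ∀ i, partialDeriv i ψ (polarPoint O R θ) = 0 := fun i =>
      image_eq_zero_of_notMem_tsupport (notMem_tsupport_partialDeriv
        (hs _ (norm_polarPoint_sub hR θ).ge) i)
    have k := fun i j => (hc2 i j).comp (Continuous.prodMk_left θ)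
    have k00 : Continuous fun r => partialDeriv 0 (partialDeriv 0 ψ) (polarPoint O r θ) := k 0 0
    have k01 : Continuous fun r => partialDeriv 1 (partialDeriv 0 ψ) (polarPoint O r θ) := k 0 1
    have k11 : Continuous fun r => partialDeriv 1 (partialDeriv 1 ψ) (polarPoint O r θ) := k 1 1
    rw [intervalIntegral.integral_eq_sub_of_hasDerivAt (fun r _ => hd r θ)
      (Continuous.intervalIntegrable (by fun_prop) _ _), hz1, hz1]
    have hO : polarPoint O 0 θ = O := by simp [polarPoint]
    rw [hO, hg]
    linear_combination (D * ((Real.sin (n * θ) * Real.cos θ - n * Real.cos (n * θ) * Real.sin θ) *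
      partialDeriv 0 ψ O + (Real.sin (n * θ) * Real.sin θ + n * Real.cos (n * θ) * Real.cos θ) *
      partialDeriv 1 ψ O)) * hl
  simp_rw [hint]
  rw [intervalIntegral.integral_const_mul, integral_grad_cone hg, mul_zero]

end Balance

/-! ### The bracket -/

section Bracket

variable {a D l : ℝ} {n : ℕ} {g : ℝ → ℝ} {W Φ : 𝓓'(Ω, ℝ)}

theorem hasBulkDensity_of_apply_eq {B : 𝓓'(Ω, ℝ)} {b : Plane → ℝ}
    (hB : ∀ ψ : 𝓓(Ω, ℝ), B ψ = ∫ x in (Ω : Set Plane), b x * ψ x) (hb : LocallyIntegrable b)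
    (hs : ContDiffOn ℝ ∞ b {O}ᶜ) : HasBulkDensity O B b where
  smooth := hs.mono fun _ hx => hx.2
  locallyIntegrable := hb.locallyIntegrableOn _
  eq_off ψ := by
    change B (extendTest ψ) = _
    rw [hB, setIntegral_mul_testFunction, setIntegral_mul_testFunction, coe_extendTest]

/-- The distribution `∇φ ⊗ ∇w`. -/
noncomputable def dyad (Ω : Opens Plane) (b₁ b₂ : Plane → ℝ) :
    Fin 2 × Fin 2 → 𝓓'(Ω, ℝ) :=
  fun p => ofFun Ω fun x => fderiv ℝ b₁ x (e p.1) * fderiv ℝ b₂ x (e p.2)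

/-- No regularization at `O` is needed: the dyad is locally integrable and homogeneous of degree
`-1`, so plain integration already gives the extension of equal degree. -/
theorem isMongeAmpereBracket_dyad (hO : O ∈ Ω) (hg : ∀ θ, g θ = a * Real.sin (n * θ))
    (hW : ∀ ψ : 𝓓(Ω, ℝ), W ψ = ∫ x in (Ω : Set Plane), cone O g x * ψ x)
    (hΦ : ∀ ψ : 𝓓(Ω, ℝ), Φ ψ = ∫ x in (Ω : Set Plane), logStress O D l x * ψ x) :
    IsMongeAmpereBracket O Φ W
      (-curl (curlTensor (dyad Ω (logStress O D l) (cone O g)))) := by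
  have hh := dyad_smul (O := O) hg D l
  have hl := fun p => locallyIntegrable_of_homogeneous (continuousOn_dyad (O := O) hg D l p) (hh p)
  have hhalf : Tendsto (fun t : ℝ => t ^ (1 / 2 : ℝ) * 1) (𝓝[>] 0) (𝓝 0) := by
    simpa using tendsto_rpow_nhdsGT_zero (s := 1 / 2) (by norm_num)
  refine ⟨_, _, _, ⟨hasBulkDensity_of_apply_eq hΦ (locallyIntegrable_logStress D l)
      (contDiffOn_logStress D l), hasBulkDensity_of_apply_eq hW (locallyIntegrable_cone hg)
      (contDiffOn_cone hg), ?_, ?_, degree_ofFun_neg hl hh⟩, ⟨fun p => ?_, ?_⟩, rfl⟩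
  · refine degree_grad_neg hΦ (locallyIntegrable_logStress D l) (logStress_smul D l) hhalf ?_
    have h := (tendsto_log_mul_rpow_nhdsGT_zero (r := 1 / 2) (by norm_num)).const_mul (D * l)
    rw [mul_zero] at h
    exact h.congr fun t => by ring
  · refine degree_grad_neg (α := fun t => t) (β := fun _ => 0) hW (locallyIntegrable_cone hg)
      (fun t ht v _ => by rw [cone_smul g ht, add_zero]) ?_ (by simp)
    have h := hhalf.mul (tendsto_id.mono_left nhdsWithin_le_nhds : Tendsto id (𝓝[>] (0 : ℝ)) (𝓝 0))
    rw [mul_zero] at h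
    exact h.congr fun t => by simp
  · exact restrictOff_ofFun ((hl p).locallyIntegrableOn _)
  · exact degree_ofFun_eq hO hl hh

theorem coe_lineDeriv_basis (ψ : 𝓓(U, ℝ)) (i : Fin 2) :
    (∂_{e i} ψ : 𝓓(U, ℝ)) = partialDeriv i ψ :=
  coe_lineDeriv ψ (e i)

theorem lap_apply (T : 𝓓'(Ω, ℝ)) (ψ : 𝓓(Ω, ℝ)) :
    lap T ψ = T (∂_{e 0} (∂_{e 0} ψ) + ∂_{e 1} (∂_{e 1} ψ)) := by
  change (∂_{e 0} (∂_{e 0} T)) ψ + (∂_{e 1} (∂_{e 1} T)) ψ = _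
  rw [Distribution.lineDerivOp_apply_apply, map_neg, Distribution.lineDerivOp_apply_apply, map_neg,
    neg_neg, Distribution.lineDerivOp_apply_apply, map_neg, Distribution.lineDerivOp_apply_apply,
    map_neg, neg_neg, map_add]

theorem curl_apply (V : Fin 2 → 𝓓'(Ω, ℝ)) (ψ : 𝓓(Ω, ℝ)) :
    curl V ψ = V 0 (∂_{e 1} ψ) - V 1 (∂_{e 0} ψ) := by
  change (∂_{e 0} (V 1)) ψ - (∂_{e 1} (V 0)) ψ = _
  simp only [Distribution.lineDerivOp_apply_apply, map_neg]
  ring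

theorem curl_curlTensor_apply (T : Fin 2 × Fin 2 → 𝓓'(Ω, ℝ)) (ψ : 𝓓(Ω, ℝ)) :
    curl (curlTensor T) ψ = T (1, 1) (∂_{e 0} (∂_{e 0} ψ)) - T (1, 0) (∂_{e 1} (∂_{e 0} ψ)) -
      T (0, 1) (∂_{e 0} (∂_{e 1} ψ)) + T (0, 0) (∂_{e 1} (∂_{e 1} ψ)) := by
  simp only [curl_apply, curlTensor]
  ring

theorem lap_lap_add_curl_curl_dyad (hg : ∀ θ, g θ = a * Real.sin (n * θ))
    (hl : a * l = a * ((n : ℝ) ^ 2 - 1))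
    (hW : ∀ ψ : 𝓓(Ω, ℝ), W ψ = ∫ x in (Ω : Set Plane), cone O g x * ψ x) :
    D • lap (lap W) + curl (curlTensor (dyad Ω (logStress O D l) (cone O g))) = 0 := by
  ext ψ
  change D * lap (lap W) ψ + curl (curlTensor (dyad Ω (logStress O D l) (cone O g))) ψ = 0
  have hh := dyad_smul (O := O) hg D l
  have hli := fun p => locallyIntegrable_of_homogeneous (continuousOn_dyad (O := O) hg D l p) (hh p)
  have hint : ∀ (p : Fin 2 × Fin 2) (η : 𝓓(Ω, ℝ)), Integrable fun x =>
      partialDeriv p.1 (logStress O D l) x *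
      partialDeriv p.2 (cone O g) x * η x := fun p η => by
    have := (hli p).integrable_smul_left_of_hasCompactSupport η.continuous η.hasCompactSupport
    refine this.congr (Eventually.of_forall fun x => ?_)
    simp only [smul_eq_mul, partialDeriv]
    ring
  have hdy : ∀ (p : Fin 2 × Fin 2) (η : 𝓓(Ω, ℝ)), dyad Ω (logStress O D l) (cone O g) p η =
      ∫ x, partialDeriv p.1 (logStress O D l) x * partialDeriv p.2 (cone O g) x * η x :=
    fun p η => ofFun_apply_eq_integral ((hli p).locallyIntegrableOn _) η
  have i00 := hint (1, 1) (∂_{e 0} (∂_{e 0} ψ))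
  have i10 := hint (1, 0) (∂_{e 1} (∂_{e 0} ψ))
  have i01 := hint (0, 1) (∂_{e 0} (∂_{e 1} ψ))
  have i11 := hint (0, 0) (∂_{e 1} (∂_{e 1} ψ))
  have e1 := integral_sub i00 i10
  have e2 := integral_sub (i00.sub i10) i01
  have e3 := integral_add ((i00.sub i10).sub i01) i11
  simp only [Pi.sub_apply] at e2 e3
  -- The right-hand `0` is replaced by the balance identity, so only the integrands have to be
  -- matched; symmetry of the second derivatives merges the two mixed terms.
  rw [← transverse_balance (O := O) hg D hl ψ.contDiff ψ.hasCompactSupport, lap_apply, lap_apply,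
    hW, setIntegral_mul_testFunction, curl_curlTensor_apply, hdy, hdy, hdy, hdy,
    ← e1, ← e2, ← e3]
  simp only [coe_lineDeriv_basis, FunLike.coe_add]
  congr 1
  refine integral_congr_ae (Eventually.of_forall fun x => ?_)
  simp only
  rw [partialDeriv_comm ψ.contDiff x 0 1]
  ring

end Bracket

end VonKarman

/-! ### The main theorem -/

theorem mainTheorem7 (Ω : TopologicalSpace.Opens Plane) (O : Plane) (hO : O ∈ Ω)
    (D a μ : ℝ) (g : ℝ → ℝ) (hg : ∀ θ, g θ = a * Real.sin (μ * θ))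
    (hper : Function.Periodic g (2 * Real.pi))
    (W Φ : 𝓓'(Ω, ℝ))
    (hW : ∀ ψ : 𝓓(Ω, ℝ), W ψ = ∫ x in (Ω : Set Plane), VonKarman.cone O g x * ψ x)
    (hΦ : ∀ ψ : 𝓓(Ω, ℝ),
      Φ ψ = ∫ x in (Ω : Set Plane), VonKarman.logStress O D (μ ^ 2 - 1) x * ψ x) :
    (∃! M : 𝓓'(Ω, ℝ), VonKarman.IsMongeAmpereBracket O Φ W M) ∧
      D • VonKarman.lap (VonKarman.lap W) - VonKarman.mongeAmpere O Φ W = 0 := by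
  obtain ⟨a', n, hg', hl⟩ := VonKarman.exists_nat_frequency hg hper
  have hM := VonKarman.isMongeAmpereBracket_dyad hO hg' hW hΦ
  refine ⟨⟨_, hM, fun M' hM' => hM'.unique hO hM⟩, ?_⟩
  -- The bracket is an arbitrary choice among admissible values; existence makes the choice
  -- admissible and uniqueness identifies it with the explicit one.
  have h : VonKarman.mongeAmpere O Φ W = _ := (Classical.epsilon_spec ⟨_, hM⟩ :
    VonKarman.IsMongeAmpereBracket O Φ W (VonKarman.mongeAmpere O Φ W)).unique hO hM
  rw [h, sub_neg_eq_add]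
  exact VonKarman.lap_lap_add_curl_curl_dyad hg' hl hW
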